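/- **Setting.** Let $\mathcal C\subset\mathbb C\cong\mathbb R^2$ be a curve with twice continuously differentiable parameterization $\xi:\mathbb R\to\mathbb C$, and let $\gamma:\mathbb R\to\mathbb R$ be locally square integrable. *Principal values.* $\mathrm{PV}_\infty\int g$ exists and equals $L$ if $\lim_n\int_{x-M_n}^{x+M_n}g=L$ for some $x\in\mathbb R$ and some $M_n\nearrow\infty$, and every choice of $x$ and $M_n\nearrow\infty$ for which the limit exists gives the same limit. $\mathrm{PV}\int g$ means that a principal value is taken both at a finite singular point and at infinity. *Cutoff functions.* A cutoff function is a $C^\infty$ function $a:\mathbb R\to\mathbb R$ with $a(s)=1$ for $|s|\le 1$, $a(s)=0$ for $|s|\ge 2$, increasing on $[-2,-1]$ and decreasing on $[1,2]$. *Assumption A.* There are a constant $c=c[\gamma]$ (it is then unique) and an antiderivative $\Gamma$ of $\tilde\gamma=\gamma-c$ such that, for some $\varepsilon>0$, $C>0$ and $0\le\beta<1$, $|\Gamma(\alpha)|\le C|\alpha|^\beta$ whenever $|\alpha|>\varepsilon$. *Assumption B.* For every $\alpha\in\mathbb R$ the integral $\mathrm{PV}\int_{-\infty}^\infty\frac{d\alpha'}{\xi(\alpha)-\xi(\alpha')}$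 converges (principal value at $\alpha'=\alpha$ and at infinity), and for every $z$ with $\mathrm{dist}(z,\mathcal C)>0$ the integral $\mathrm{PV}_\infty\int_{-\infty}^\infty\frac{d\alpha'}{z-\xi(\alpha')}$ converges. *Chord-arc condition.* There is $K>0$ with $|\xi(\alpha)-\xi(\alpha')|\ge K|\alpha-\alpha'|$ for all $\alpha,\alpha'$. *Assumption C.* There are sequences $\alpha_n\to\infty$, $\alpha_{-n}\to-\infty$, curves $\xi^n\in C^2(\mathbb R;\mathbb C)$, each satisfying the chord-arc condition, and functions $\tilde\gamma^n\in L^2(\mathbb R)$ with $\xi^n(\alpha)-\alpha\in L^2(\mathbb R)$, such that: $\xi^n=\xi$ and $\tilde\gamma^n=\tilde\gamma$ on $[\alpha_{-n},\alpha_n]$; for every compact $K_0\subset\mathbb C$ there are $N$ and $A_\pm\in\mathbb R$ with $\xi^n(\alpha)\notin K_0$ for all $n\ge N$ and $\alpha\notin[A_-,A_+]$; and, with $\Gamma^n(\alpha)=\int_0^\alpha\tilde\gamma^n$ and $\Omega_n=(-\infty,\alpha_{-n}]\cup[\alpha_n,\infty)$, for every compact $K_0$ the integrals $\int_{\Omega_n}\frac{|\xi^n_\alpha(\alpha')|\,|\Gamma^n(\alpha')|}{|z-\xi^n(\alpha')|^2}\,d\alpha'$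 tend to $0$ as $n\to\infty$, uniformly in $z\in K_0$. *Velocity.* For a cutoff function $a$ and $z\notin\mathcal C$ let $(u-iv)(z)=I_0+I_1+I_2+I_3$, where $$I_0=\frac1{2\pi i}\mathrm{PV}_\infty\!\int_{-\infty}^{\infty}\frac{c[\gamma]}{z-\xi(\alpha')}\,d\alpha',\qquad I_1=\frac1{2\pi i}\int_{-\infty}^{\infty}\frac{a(|z-\xi(\alpha')|^2)\,\tilde\gamma(\alpha')}{z-\xi(\alpha')}\,d\alpha',$$ $$I_2=-\frac1{2\pi i}\int_{-\infty}^{\infty}\frac{2a'(|z-\xi(\alpha')|^2)\,\mathrm{Re}\big(\xi_\alpha(\alpha')\overline{(z-\xi(\alpha'))}\big)\,\Gamma(\alpha')}{z-\xi(\alpha')}\,d\alpha',$$ $$I_3=-\frac1{2\pi i}\int_{-\infty}^{\infty}\frac{\big(1-a(|z-\xi(\alpha')|^2)\big)\,\xi_\alpha(\alpha')\,\Gamma(\alpha')}{(z-\xi(\alpha'))^2}\,d\alpha'.$$ **Theorem.** Suppose that Assumptions A and C hold, that Assumption B holds or $c[\gamma]=0$, that $\xi$ satisfies the chord-arc condition,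 that there is $M>0$ with $\frac1M\le|\xi_\alpha(\alpha)|\le M$ for all $\alpha$, and that $\xi(\alpha)-\alpha=f_1(\alpha)+f_2(\alpha)$ with $f_1\in L^2(\mathbb R)$ and $f_2\in L^\infty(\mathbb R)$. Then, for every cutoff function $a$, the integrals defining $u-iv$ converge at every $z\notin\mathcal C$ (the last three absolutely), $(u,v)$ is locally integrable on $\mathbb R^2$, and in the sense of distributions $$u_x+v_y=0,\qquad v_x-u_y=\gamma\,\delta_{\mathcal C},\qquad\text{where }\langle\gamma\delta_{\mathcal C},\varphi\rangle=\int_{\mathbb R}\gamma(\alpha)\,\varphi(\xi(\alpha))\,d\alpha\quad(\varphi\in C_c^\infty(\mathbb R^2)).$$ Moreover, for every $z\notin\mathcal C$, the value $(u-iv)(z)$ does not depend on the choice of the cutoff function $a$. -/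

import Mathlib

open MeasureTheory Filter Topology Set
open scoped ContDiff ENNReal

noncomputable section

/-- Smooth cutoff functions: `a = 1` on `|s| ≤ 1`, `a = 0` on `|s| ≥ 2`, monotone in between. -/
structure IsCutoff (a : ℝ → ℝ) : Prop where
  smooth : ContDiff ℝ ∞ a
  eq_one : ∀ s, |s| ≤ 1 → a s = 1
  eq_zero : ∀ s, 2 ≤ |s| → a s = 0
  increasing : MonotoneOn a (Icc (-2) (-1))
  decreasing : AntitoneOn a (Icc 1 2)

/-- `γ` is locally square integrable on the line. -/
def IsLocallyL2 (γ : ℝ → ℝ) : Prop :=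
  ∀ K : Set ℝ, IsCompact K → MemLp γ 2 (volume.restrict K)

/-- `Γ` is an antiderivative of `γ - c` (in the Lebesgue sense) that grows sublinearly. -/
structure IsSublinearPrimitive (γ : ℝ → ℝ) (c : ℝ) (Γ : ℝ → ℝ) : Prop where
  locallyIntegrable : LocallyIntegrable γ volume
  integral_eq : ∀ x y : ℝ, ∫ s in x..y, (γ s - c) = Γ y - Γ x
  growth : ∃ ε > (0 : ℝ), ∃ C > (0 : ℝ), ∃ β : ℝ, 0 ≤ β ∧ β < 1 ∧
    ∀ α : ℝ, ε < |α| → |Γ α| / |α| ^ β ≤ C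

theorem IsSublinearPrimitive.tendsto_div {γ Γ : ℝ → ℝ} {c : ℝ}
    (h : IsSublinearPrimitive γ c Γ) : Tendsto (fun α => Γ α / α) atTop (𝓝 0) := by
  obtain ⟨ε, hε, C, hC, β, hβ0, hβ1, hb⟩ := h.growth
  have h1 : Tendsto (fun α : ℝ => C * α ^ (-(1 - β))) atTop (𝓝 0) := by
    simpa using (tendsto_rpow_neg_atTop (sub_pos.2 hβ1)).const_mul C
  refine squeeze_zero_norm' ?_ h1
  filter_upwards [eventually_gt_atTop ε] with α hα
  have hα0 : 0 < α := hε.trans hα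
  have h2 := hb α (by rwa [abs_of_pos hα0])
  rw [abs_of_pos hα0, div_le_iff₀ (Real.rpow_pos_of_pos hα0 β)] at h2
  rw [norm_div, Real.norm_eq_abs, Real.norm_eq_abs, abs_of_pos hα0, div_le_iff₀ hα0, mul_assoc]
  have h3 : α ^ (-(1 - β)) * α = α ^ β := by
    conv_lhs => rw [← Real.rpow_add_one hα0.ne']
    congr 1
    ring
  rwa [h3]

/-- The constant `c` with a sublinear antiderivative of `γ - c` is unique; it is written `c[γ]`. -/
theorem IsSublinearPrimitive.const_unique {γ Γ Γ' : ℝ → ℝ} {c c' : ℝ}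
    (h : IsSublinearPrimitive γ c Γ) (h' : IsSublinearPrimitive γ c' Γ') : c = c' := by
  have hi : ∀ x y : ℝ, IntervalIntegrable γ volume x y := fun x y =>
    (h.locallyIntegrable.integrableOn_isCompact isCompact_uIcc).intervalIntegrable
  have key : ∀ y : ℝ, Γ y - Γ' y = (Γ 0 - Γ' 0) + (c' - c) * y := by
    intro y
    have e1 := h.integral_eq 0 y
    have e2 := h'.integral_eq 0 y
    rw [intervalIntegral.integral_sub (hi 0 y) intervalIntegrable_const,
      intervalIntegral.integral_const] at e1 e2
    simp only [smul_eq_mul] at e1 e2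
    linarith
  have t1 : Tendsto (fun α => Γ α / α - Γ' α / α) atTop (𝓝 0) := by
    simpa using h.tendsto_div.sub h'.tendsto_div
  have t2 : Tendsto (fun α : ℝ => (Γ 0 - Γ' 0) / α + (c' - c)) atTop (𝓝 (c' - c)) := by
    simpa using (tendsto_const_nhds.div_atTop tendsto_id).add_const (c' - c)
  have t3 : Tendsto (fun α => Γ α / α - Γ' α / α) atTop (𝓝 (c' - c)) := by
    refine t2.congr' ?_
    filter_upwards [eventually_gt_atTop 0] with α hα
    rw [← sub_div, key α, add_div, mul_div_cancel_right₀ _ hα.ne']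
  linarith [tendsto_nhds_unique t1 t3]

/-- `L` is the principal value at infinity of `∫ g`: for some centre `x` and some radii
`M n ↗ ∞` the symmetric integrals converge to `L`, and any choice of centre and radii
for which they converge gives the same limit. -/
def HasPVInfty (g : ℝ → ℂ) (L : ℂ) : Prop :=
  LocallyIntegrable g volume ∧
  (∃ (x : ℝ) (M : ℕ → ℝ), Monotone M ∧ Tendsto M atTop atTop ∧
    Tendsto (fun n => ∫ s in (x - M n)..(x + M n), g s) atTop (𝓝 L)) ∧
  ∀ (x : ℝ) (M : ℕ → ℝ) (L' : ℂ), Monotone M → Tendsto M atTop atTop →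
    Tendsto (fun n => ∫ s in (x - M n)..(x + M n), g s) atTop (𝓝 L') → L' = L

/-- The principal value of `∫ g`, both at the point `p` and at infinity, exists. -/
def PVConverges (g : ℝ → ℂ) (p : ℝ) : Prop :=
  LocallyIntegrableOn g {p}ᶜ volume ∧
  (∃ N : ℂ, Tendsto (fun ε : ℝ => ∫ s in {s : ℝ | ε < |s - p| ∧ |s - p| < 1}, g s)
    (𝓝[>] 0) (𝓝 N)) ∧
  ∃ F : ℂ, HasPVInfty ({s : ℝ | 1 ≤ |s - p|}.indicator g) F

open Classical in
/-- The value of the principal value at infinity (and `0` if it does not exist). -/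
def pvInfty (g : ℝ → ℂ) : ℂ :=
  if h : ∃ L, HasPVInfty g L then h.choose else 0

/-- The principal value integrals of `1 / (ξ(α) - ξ(α'))` and `1 / (z - ξ(α'))` converge. -/
structure CauchyPVConverges (ξ : ℝ → ℂ) : Prop where
  on_curve : ∀ α : ℝ, PVConverges (fun s => 1 / (ξ α - ξ s)) α
  off_curve : ∀ z : ℂ, 0 < Metric.infDist z (range ξ) →
    ∃ L, HasPVInfty (fun s => 1 / (z - ξ s)) L

/-- The chord-arc condition. -/
def ChordArc (ξ : ℝ → ℂ) : Prop :=
  ∃ K > (0 : ℝ), ∀ α α' : ℝ, K * |α - α'| ≤ ‖ξ α - ξ α'‖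

/-- The sheet with position `ξ` and modified strength `γt` (that is, `γ - c[γ]`) can be
approximated by decaying sheets with positions `ξn n` and modified strengths `γn n`, which agree
with it on `[αm n, αp n]`, in such a way that the far-field integrals tend to zero uniformly on
compact sets. -/
def ApproximableByDecaying (ξ : ℝ → ℂ) (γt : ℝ → ℝ) : Prop :=
  ∃ (αp αm : ℕ → ℝ) (ξn : ℕ → ℝ → ℂ) (γn : ℕ → ℝ → ℝ),
    Tendsto αp atTop atTop ∧ Tendsto αm atTop atBot ∧
    (∀ n, ∀ α ∈ Icc (αm n) (αp n), ξn n α = ξ α ∧ γn n α = γt α) ∧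
    (∀ n, MemLp (fun α : ℝ => ξn n α - (α : ℂ)) 2 volume ∧ MemLp (γn n) 2 volume) ∧
    (∀ n, ContDiff ℝ 2 (ξn n)) ∧
    (∀ n, ChordArc (ξn n)) ∧
    (∀ K₀ : Set ℂ, IsCompact K₀ → ∃ (N : ℕ) (Am Ap : ℝ), ∀ n ≥ N, ∀ α ∉ Icc Am Ap,
      ξn n α ∉ K₀) ∧
    (∀ K₀ : Set ℂ, IsCompact K₀ → ∀ ε > (0 : ℝ), ∃ N : ℕ, ∀ n ≥ N, ∀ z ∈ K₀,
      ∫⁻ s in Iic (αm n) ∪ Ici (αp n),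
        ENNReal.ofReal (‖deriv (ξn n) s‖ * |∫ t in (0 : ℝ)..s, γn n t|)
          / ENNReal.ofReal (‖z - ξn n s‖ ^ 2) ≤ ENNReal.ofReal ε)

/-- Integrand of `I₀` (without the factor `1 / (2πi)`). -/
def integrand₀ (ξ : ℝ → ℂ) (c : ℝ) (z : ℂ) (s : ℝ) : ℂ :=
  (c : ℂ) / (z - ξ s)

/-- Integrand of `I₁` (without the factor `1 / (2πi)`). -/
def integrand₁ (a : ℝ → ℝ) (ξ : ℝ → ℂ) (γ : ℝ → ℝ) (c : ℝ) (z : ℂ) (s : ℝ) : ℂ :=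
  ((a (‖z - ξ s‖ ^ 2) * (γ s - c) : ℝ) : ℂ) / (z - ξ s)

/-- Integrand of `I₂` (without the factor `-1 / (2πi)`).  The factor `2` comes from
`∂ₛ |z - ξ(s)|² = -2 Re (ξ'(s) conj (z - ξ(s)))`. -/
def integrand₂ (a : ℝ → ℝ) (ξ : ℝ → ℂ) (Γ : ℝ → ℝ) (z : ℂ) (s : ℝ) : ℂ :=
  ((2 * deriv a (‖z - ξ s‖ ^ 2) * (deriv ξ s * starRingEnd ℂ (z - ξ s)).re * Γ s : ℝ) : ℂ)
    / (z - ξ s)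

/-- Integrand of `I₃` (without the factor `-1 / (2πi)`). -/
def integrand₃ (a : ℝ → ℝ) (ξ : ℝ → ℂ) (Γ : ℝ → ℝ) (z : ℂ) (s : ℝ) : ℂ :=
  ((1 - a (‖z - ξ s‖ ^ 2) : ℝ) : ℂ) * deriv ξ s * (Γ s : ℂ) / (z - ξ s) ^ 2

/-- The complex velocity `u - iv = I₀ + I₁ + I₂ + I₃`. It is meaningful off the curve; its values
on the curve, a null set, are irrelevant. -/
def sheetVelocity (a : ℝ → ℝ) (ξ : ℝ → ℂ) (γ : ℝ → ℝ) (c : ℝ) (Γ : ℝ → ℝ) (z : ℂ) : ℂ :=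
  1 / (2 * Real.pi * Complex.I) * pvInfty (integrand₀ ξ c z)
    + 1 / (2 * Real.pi * Complex.I) * (∫ s : ℝ, integrand₁ a ξ γ c z s)
    + -(1 / (2 * Real.pi * Complex.I)) * (∫ s : ℝ, integrand₂ a ξ Γ z s)
    + -(1 / (2 * Real.pi * Complex.I)) * (∫ s : ℝ, integrand₃ a ξ Γ z s)

/-- All integrals in the definition of the velocity at `z` converge. -/
structure SheetVelocityConverges (a : ℝ → ℝ) (ξ : ℝ → ℂ) (γ : ℝ → ℝ) (c : ℝ) (Γ : ℝ → ℝ)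
    (z : ℂ) : Prop where
  conv₀ : ∃ L, HasPVInfty (integrand₀ ξ c z) L
  conv₁ : Integrable (integrand₁ a ξ γ c z) volume
  conv₂ : Integrable (integrand₂ a ξ Γ z) volume
  conv₃ : Integrable (integrand₃ a ξ Γ z) volume

/-- The planar field with complex form `w = u - iv`, i.e. `u = Re w` and `v = -Im w`, is
divergence-free in the sense of distributions: `∫ (u φ_x + v φ_y) = 0`. -/
def DivergenceFree (w : ℂ → ℂ) : Prop :=
  ∀ φ : ℂ → ℝ, ContDiff ℝ ∞ φ → HasCompactSupport φ →
    ∫ z : ℂ, ((w z).re * fderiv ℝ φ z 1 + (-(w z).im) * fderiv ℝ φ z Complex.I) = 0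

/-- The planar field with complex form `w = u - iv` has distributional vorticity
`v_x - u_y = γ δ_C`, where `γ δ_C` is the distribution `φ ↦ ∫ γ(α) φ(ξ(α)) dα`. -/
def HasSheetVorticity (w : ℂ → ℂ) (γ : ℝ → ℝ) (ξ : ℝ → ℂ) : Prop :=
  ∀ φ : ℂ → ℝ, ContDiff ℝ ∞ φ → HasCompactSupport φ →
    -∫ z : ℂ, ((-(w z).im) * fderiv ℝ φ z 1 - (w z).re * fderiv ℝ φ z Complex.I)
      = ∫ α : ℝ, γ α * φ (ξ α)

end

/-!
The velocity `w = u - iv` should satisfy `2 ∂̄ w = -i γ δ_C`, whose real and imaginary parts are the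
two differential equations. This comes from the Cauchy–Pompeiu formula
(`integral_dbarTwice_div_sub`) once `w` is, on a given ball of radius `R`, the integral over the
curve parameter of a kernel that is jointly integrable, so that Fubini's theorem applies.

Such a kernel is found by replacing the cutoff `a (|z - ξ s|²)`, which depends on `z`, by a cutoff
`χ s` in the parameter that equals `1` wherever the curve is near the ball. The integrands before
and after the change differ by the derivative of a compactly supported absolutely continuous
function, so `I₁ + I₂ + I₃` does not change
(`sheetVelocity_eq_integral_velocityKernel`); as `χ` does not involve `a`, this also shows that the
velocity does not depend on `a`. The new kernel is the Cauchy kernel of a compactly supported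
integrable density, equal to `γ - c` where the curve meets the ball, minus the far kernel
`(1 - χ) ξ' Γ / (z - ξ)²`, which is holomorphic on the ball and decays like `|s| ^ (β - 2)` by the
chord-arc condition.

For the constant part `I₀`, the chord-arc condition and the decomposition of `ξ s - s` into a square
integrable and a bounded function show that `1 / (z - ξ s) + 1 / s` is integrable at infinity. Since
`1 / s` is odd, the principal value is the integral of this regularized kernel
(`hasPVInfty_integrand₀`), which is again holomorphic on the ball for large `|s|`.
-/

/-! ### The Cauchy–Pompeiu formula -/

/-- The operator `2 ∂̄ = ∂ₓ + i ∂_y` applied to a real function on the plane. -/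
noncomputable def dbarTwice (φ : ℂ → ℝ) (z : ℂ) : ℂ :=
  (fderiv ℝ φ z 1 : ℂ) + (fderiv ℝ φ z Complex.I : ℂ) * Complex.I

theorem integrable_truncated_inv_norm :
    Integrable (fun w : ℂ => (Iio (1 : ℝ)).indicator (fun r => r⁻¹) ‖w‖) := by
  rw [integrable_fun_norm_addHaar (μ := (volume : Measure ℂ))
    (f := (Iio (1 : ℝ)).indicator (fun r => r⁻¹))]
  have h : IntegrableOn (fun _ : ℝ => (1 : ℝ)) (Ioo 0 1) := by simp
  have h2 : IntegrableOn ((Ioo (0 : ℝ) 1).indicator (fun _ : ℝ => (1 : ℝ))) (Ioi 0) :=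
    ((integrable_indicator_iff measurableSet_Ioo).2 h).integrableOn
  refine h2.congr_fun ?_ measurableSet_Ioi
  intro r hr
  have hr0 : (0 : ℝ) < r := hr
  by_cases h1 : r < 1 <;> simp [h1, hr0, hr0.ne']

theorem continuous_fderiv_apply {φ : ℂ → ℝ} (hφ : ContDiff ℝ ∞ φ) :
    Continuous fun q : ℂ × ℂ => fderiv ℝ φ q.1 q.2 :=
  hφ.continuous_fderiv_apply (by simp)

theorem continuous_dbarTwice {φ : ℂ → ℝ} (hφ : ContDiff ℝ ∞ φ) : Continuous (dbarTwice φ) := by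
  have h := continuous_fderiv_apply hφ
  unfold dbarTwice
  have h1 : Continuous fun z => fderiv ℝ φ z 1 :=
    h.comp (by fun_prop : Continuous fun z : ℂ => (z, (1 : ℂ)))
  have h2 : Continuous fun z => fderiv ℝ φ z Complex.I :=
    h.comp (by fun_prop : Continuous fun z : ℂ => (z, Complex.I))
  fun_prop

theorem support_dbarTwice_subset (φ : ℂ → ℝ) : Function.support (dbarTwice φ) ⊆ tsupport φ := by
  intro z hz
  by_contra h
  apply hz
  have := image_eq_zero_of_notMem_tsupport (fun h' => h (tsupport_fderiv_subset ℝ h'))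
  simp [dbarTwice, this]

theorem hasCompactSupport_dbarTwice {φ : ℂ → ℝ} (hφ : HasCompactSupport φ) :
    HasCompactSupport (dbarTwice φ) :=
  HasCompactSupport.of_support_subset_isCompact hφ (support_dbarTwice_subset φ)

/-- A function holomorphic near the support of `φ` satisfies `∂̄ g = 0` when tested against `φ`. The
function `g` is arbitrary (possibly not even measurable) off `U`. -/
theorem integral_dbarTwice_mul_of_holomorphic {φ : ℂ → ℝ} (hφ : ContDiff ℝ ∞ φ)
    (hc : HasCompactSupport φ) {U : Set ℂ} (hU : IsOpen U) (hsupp : tsupport φ ⊆ U) {g : ℂ → ℂ}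
    (hg : DifferentiableOn ℂ g U) : ∫ z, dbarTwice φ z * g z = 0 := by
  have hcont : ContinuousOn g U := hg.continuousOn
  have hcont' : ContinuousOn (deriv g) U := (hg.deriv hU).continuousOn
  have hint : ∀ (f : ℂ → ℝ) (k : ℂ → ℂ), Continuous f → tsupport f ⊆ tsupport φ →
      ContinuousOn k U → Integrable (fun z => (f z : ℂ) * k z) := by
    intro f k hf hfs hk
    have hcompact : IsCompact (tsupport φ) := hc
    refine (integrableOn_iff_integrable_of_support_subset (s := tsupport φ) ?_).1 ?_
    · intro z hz
      by_contra h
      exact hz (by simp [image_eq_zero_of_notMem_tsupport (fun h' => h (hfs h'))])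
    · exact ContinuousOn.integrableOn_compact hcompact
        ((Complex.continuous_ofReal.comp hf).continuousOn.mul (hk.mono hsupp))
  have hd : ∀ v : ℂ, Continuous fun z => fderiv ℝ φ z v := fun v =>
    (continuous_fderiv_apply hφ).comp (by fun_prop : Continuous fun z : ℂ => (z, v))
  have hds : ∀ v : ℂ, tsupport (fun z => fderiv ℝ φ z v) ⊆ tsupport φ := fun v =>
    tsupport_fderiv_apply_subset ℝ v
  have key : ∀ v : ℂ, ∫ z, (φ z : ℂ) * (v * deriv g z) =
      -∫ z, (fderiv ℝ φ z v : ℂ) * g z := by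
    intro v
    refine integral_bilinear_hasLineDerivAt_right_eq_neg_left_of_integrable (μ := volume)
      (f := fun z => (φ z : ℂ)) (f' := fun z => (fderiv ℝ φ z v : ℂ)) (g := g)
      (g' := fun z => v * deriv g z) (v := v) (B := ContinuousLinearMap.mul ℝ ℂ) ?_ ?_ ?_ ?_ ?_
    · exact hint _ _ (hd v) (hds v) hcont
    · exact hint _ _ hφ.continuous subset_rfl (continuousOn_const.mul hcont')
    · exact hint _ _ hφ.continuous subset_rfl hcont
    · intro x _
      have h1 : HasFDerivAt φ (fderiv ℝ φ x) x :=
        (hφ.differentiable (by simp)).differentiableAt.hasFDerivAt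
      exact (Complex.ofRealCLM.hasFDerivAt.comp x h1).hasLineDerivAt v
    · intro x hx
      have hxU : x ∈ U := hsupp (closure_mono (by intro y hy; simpa using hy) hx)
      have h1 : HasDerivAt g (deriv g x) x :=
        (hg.differentiableAt (hU.mem_nhds hxU)).hasDerivAt
      have := (h1.hasFDerivAt.restrictScalars ℝ).hasLineDerivAt v
      simpa using this
  have k1 := key 1
  have kI := key Complex.I
  have e1 : ∫ z, (φ z : ℂ) * (Complex.I * deriv g z) =
      Complex.I * ∫ z, (φ z : ℂ) * (1 * deriv g z) := by
    rw [← integral_const_mul]; congr 1; ext z; ring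
  have e2 : ∫ z, dbarTwice φ z * g z = (∫ z, (fderiv ℝ φ z 1 : ℂ) * g z) +
      Complex.I * ∫ z, (fderiv ℝ φ z Complex.I : ℂ) * g z := by
    rw [← integral_const_mul, ← integral_add (hint _ _ (hd 1) (hds 1) hcont)
      ((hint _ _ (hd Complex.I) (hds Complex.I) hcont).const_mul _)]
    congr 1; ext z; simp only [dbarTwice]; ring
  rw [e2]
  linear_combination k1 + Complex.I * kI - Complex.I * e1
    - (∫ z, (φ z : ℂ) * (1 * deriv g z)) * Complex.I_mul_I

open Complex in
/-- The Cauchy–Pompeiu formula: `1 / (π (z - p))` is a fundamental solution of `∂̄`. In polar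
coordinates around `p` the integrand times the Jacobian is `∂φ/∂r + (i/r) ∂φ/∂θ`; the first term
integrates to `-φ p` on every ray, and the second to zero on every circle. -/
theorem integral_dbarTwice_div_sub {φ : ℂ → ℝ} (hφ : ContDiff ℝ ∞ φ)
    (hc : HasCompactSupport φ) (p : ℂ) :
    ∫ z, dbarTwice φ z / (z - p) = -(2 * Real.pi) * φ p := by
  obtain ⟨R, hR⟩ : ∃ R : ℝ, ∀ r : ℝ, R ≤ r → ∀ θ : ℝ,
      p + r * exp (θ * I) ∉ tsupport φ := by
    obtain ⟨R, hR⟩ := hc.isCompact.isBounded.subset_ball p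
    refine ⟨max R 1, fun r hr θ h => ?_⟩
    have := hR h
    have hr1 : (1 : ℝ) ≤ r := (le_max_right _ _).trans hr
    simp [norm_exp_ofReal_mul_I, abs_of_pos (zero_lt_one.trans_le hr1)] at this
    exact absurd ((le_max_left _ _).trans hr) (not_le.2 this)
  set e : ℝ → ℂ := fun θ => exp (θ * I)
  have he : Continuous e := by fun_prop
  have hderiv : ∀ x, HasFDerivAt φ (fderiv ℝ φ x) x := fun x =>
    (hφ.differentiable (by simp)).differentiableAt.hasFDerivAt
  have hfz : ∀ r : ℝ, R ≤ r → ∀ θ : ℝ, fderiv ℝ φ (p + r * e θ) = 0 := fun r hr θ =>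
    image_eq_zero_of_notMem_tsupport fun h => hR r hr θ (tsupport_fderiv_subset ℝ h)
  -- radial and angular derivatives
  set A : ℝ × ℝ → ℝ := fun q => fderiv ℝ φ (p + q.1 * e q.2) (e q.2)
  set B : ℝ × ℝ → ℝ := fun q => fderiv ℝ φ (p + q.1 * e q.2) (I * e q.2)
  have hA : Continuous A := (continuous_fderiv_apply hφ).comp
    (by fun_prop : Continuous fun q : ℝ × ℝ => (p + q.1 * e q.2, e q.2))
  have hB : Continuous B := (continuous_fderiv_apply hφ).comp
    (by fun_prop : Continuous fun q : ℝ × ℝ => (p + q.1 * e q.2, I * e q.2))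
  set T : Set (ℝ × ℝ) := Ioi (0 : ℝ) ×ˢ Ioo (-Real.pi) Real.pi
  have hT : MeasurableSet T := measurableSet_Ioi.prod measurableSet_Ioo
  have hint : ∀ F : ℝ × ℝ → ℝ, Continuous F → (∀ r, R ≤ r → ∀ θ, F (r, θ) = 0) →
      IntegrableOn F T (volume.prod volume) := by
    intro F hF h0
    have h1 : IntegrableOn F (Icc 0 R ×ˢ Icc (-Real.pi) Real.pi) (volume.prod volume) :=
      hF.continuousOn.integrableOn_compact (isCompact_Icc.prod isCompact_Icc)
    refine h1.of_forall_sdiff_eq_zero hT ?_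
    rintro ⟨r, θ⟩ ⟨⟨hr, hθ⟩, h⟩
    apply h0
    by_contra! hlt
    exact h ⟨⟨le_of_lt hr, hlt.le⟩, Ioo_subset_Icc_self hθ⟩
  have hAi : IntegrableOn A T (volume.prod volume) :=
    hint A hA fun r hr θ => by simp [A, hfz r hr θ]
  have hBi : IntegrableOn B T (volume.prod volume) :=
    hint B hB fun r hr θ => by simp [B, hfz r hr θ]
  have intA : ∫ q in T, A q ∂(volume.prod volume) = -(2 * Real.pi) * φ p := by
    have h1 : ∀ θ, ∫ r in Ioi (0 : ℝ), A (r, θ) = -φ p := by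
      intro θ
      have hd : ∀ r ∈ Ici (0 : ℝ), HasDerivAt (fun r : ℝ => φ (p + r * e θ)) (A (r, θ)) r := by
        intro r _
        have h2 : HasDerivAt (fun r : ℝ => p + r * e θ) (e θ) r := by
          simpa using ((hasDerivAt_id r).ofReal_comp.mul_const (e θ)).const_add p
        exact (hderiv (p + r * e θ)).comp_hasDerivAt r h2
      have hi : IntegrableOn (fun r => A (r, θ)) (Ioi 0) := by
        have : IntegrableOn (fun r => A (r, θ)) (Icc 0 R) :=
          (hA.comp (by fun_prop : Continuous fun r : ℝ => (r, θ))).continuousOn.integrableOn_compact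
            isCompact_Icc
        refine this.of_forall_sdiff_eq_zero measurableSet_Ioi ?_
        rintro r ⟨hr, h⟩
        have : R ≤ r := by
          by_contra! hlt
          exact h ⟨le_of_lt hr, hlt.le⟩
        simp [A, hfz r this θ]
      have ht : Tendsto (fun r : ℝ => φ (p + r * e θ)) atTop (𝓝 0) := by
        refine tendsto_const_nhds.congr' ?_
        filter_upwards [eventually_ge_atTop R] with r hr
        exact (image_eq_zero_of_notMem_tsupport (hR r hr θ)).symm
      rw [integral_Ioi_of_hasDerivAt_of_tendsto' hd hi ht]
      simp
    rw [← Measure.prod_restrict, integral_prod_symm _ (by rw [Measure.prod_restrict]; exact hAi)]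
    simp only [h1, integral_const]
    rw [measureReal_restrict_apply_univ, Real.volume_real_Ioo_of_le (by linarith [Real.pi_pos]),
      smul_eq_mul]
    ring
  have intB : ∫ q in T, B q ∂(volume.prod volume) = 0 := by
    rw [setIntegral_prod _ hBi]
    refine setIntegral_eq_zero_of_forall_eq_zero fun r hr => ?_
    have hr0 : r ≠ 0 := ne_of_gt hr
    rw [← integral_Ioc_eq_integral_Ioo,
      ← intervalIntegral.integral_of_le (by linarith [Real.pi_pos])]
    have hd : ∀ θ ∈ uIcc (-Real.pi) Real.pi,
        HasDerivAt (fun θ : ℝ => r⁻¹ * φ (p + r * e θ)) (B (r, θ)) θ := by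
      intro θ _
      have h2 : HasDerivAt (fun θ : ℝ => p + r * e θ) ((r : ℂ) * (I * e θ)) θ := by
        have h3 : HasDerivAt e (e θ * I) θ := by
          simpa using ((hasDerivAt_id θ).ofReal_comp.mul_const I).cexp
        have := (h3.const_mul (r : ℂ)).const_add p
        rwa [mul_comm (e θ) I] at this
      have h4 := ((hderiv (p + r * e θ)).comp_hasDerivAt θ h2).const_mul r⁻¹
      have h5 : B (r, θ) = r⁻¹ * fderiv ℝ φ (p + r * e θ) ((r : ℂ) * (I * e θ)) := by
        have h6 : (r : ℂ) * (I * e θ) = r • (I * e θ) := (real_smul ..).symm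
        rw [h6, map_smul, smul_eq_mul, inv_mul_cancel_left₀ hr0]
      rw [h5]
      exact h4
    rw [intervalIntegral.integral_eq_sub_of_hasDerivAt hd
      ((hB.comp (by fun_prop : Continuous fun θ : ℝ => (r, θ))).intervalIntegrable _ _)]
    have : e Real.pi = e (-Real.pi) := by
      simp only [e, exp_pi_mul_I, ofReal_neg, neg_mul, exp_neg]
      norm_num
    simp [this]
  rw [← integral_add_right_eq_self _ p, ← Complex.integral_comp_polarCoord_symm]
  have e3 : ∀ q ∈ polarCoord.target, q.1 • (dbarTwice φ (Complex.polarCoord.symm q + p) /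
      (Complex.polarCoord.symm q + p - p)) = (A q : ℂ) + (B q : ℂ) * I := by
    rintro ⟨r, θ⟩ ⟨hr, _⟩
    have hr0 : (r : ℂ) ≠ 0 := by exact_mod_cast ne_of_gt hr
    have hsymm : Complex.polarCoord.symm (r, θ) = r * e θ := by
      simp [e, exp_mul_I]
    rw [hsymm, add_sub_cancel_right, add_comm (_ * _) p]
    have hl : ∀ w : ℂ, fderiv ℝ φ (p + r * e θ) w =
        w.re * fderiv ℝ φ (p + r * e θ) 1 + w.im * fderiv ℝ φ (p + r * e θ) I := by
      intro w
      have hw : w = w.re • (1 : ℂ) + w.im • I := by simp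
      conv_lhs => rw [hw]
      rw [map_add, map_smul, map_smul, smul_eq_mul, smul_eq_mul]
    have he0 : e θ ≠ 0 := exp_ne_zero _
    have hre : (e θ).re = Real.cos θ := exp_ofReal_mul_I_re θ
    have him : (e θ).im = Real.sin θ := exp_ofReal_mul_I_im θ
    have h2 : e θ = Real.cos θ + Real.sin θ * I := by rw [← hre, ← him, re_add_im]
    have h1 : ((Real.cos θ : ℂ)) ^ 2 + (Real.sin θ : ℂ) ^ 2 = 1 := by
      exact_mod_cast Real.cos_sq_add_sin_sq θ
    simp only [A, B, dbarTwice]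
    rw [hl (e θ), hl (I * e θ), real_smul, mul_div_assoc', mul_div_mul_left _ _ hr0,
      div_eq_iff he0]
    simp only [mul_re, mul_im, I_re, I_im, hre, him]
    generalize fderiv ℝ φ (p + r * e θ) 1 = a
    generalize fderiv ℝ φ (p + r * e θ) I = b
    rw [h2]
    generalize Real.cos θ = C at h1 ⊢
    generalize Real.sin θ = S at h1 ⊢
    push_cast
    linear_combination -(a + b * I) * h1 + ((a + b * I) * S ^ 2 - b * S * (C + S * I)) * I_mul_I
  rw [setIntegral_congr_fun (by exact hT) e3]
  change ∫ q in T, ((A q : ℂ) + (B q : ℂ) * I) ∂(volume.prod volume) = _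
  have hAi' : IntegrableOn (fun q => (A q : ℂ)) T (volume.prod volume) := hAi.ofReal
  have hBi' : IntegrableOn (fun q => (B q : ℂ)) T (volume.prod volume) := hBi.ofReal
  rw [integral_add hAi' (hBi'.mul_const I), integral_mul_const, integral_complex_ofReal,
    integral_complex_ofReal, intA, intB]
  simp

/-! ### Superpositions of kernels -/

/-- The kernel `m s / (z - ξ s)` is jointly integrable over a ball and the line, because
`1 / |z - p|` is integrable over the unit disc around `p`, with an integral independent of `p`. -/
theorem integrable_cauchyKernel {m : ℝ → ℂ} (hm : Integrable m) {ξ : ℝ → ℂ} (hξ : Continuous ξ)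
    (R : ℝ) : Integrable (fun q : ℂ × ℝ => m q.2 / (q.1 - ξ q.2))
      ((volume.restrict (Metric.ball (0 : ℂ) R)).prod volume) := by
  set k : ℂ → ℝ := fun w => (Iio (1 : ℝ)).indicator (fun r => r⁻¹) ‖w‖ with hk
  have hk0 : ∀ w, 0 ≤ k w := fun w => by
    simp only [hk, indicator]
    split_ifs <;> positivity
  have hkm : Measurable k :=
    (measurable_inv.indicator measurableSet_Iio).comp measurable_norm
  have hki : Integrable k := integrable_truncated_inv_norm
  have hfin : IsFiniteMeasure ((volume : Measure ℂ).restrict (Metric.ball (0 : ℂ) R)) :=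
    isFiniteMeasure_restrict.2 measure_ball_lt_top.ne
  have hsub : Measurable fun q : ℂ × ℝ => q.1 - ξ q.2 := by
    have := hξ.measurable
    fun_prop
  have h1 : Integrable (fun q : ℂ × ℝ => ‖m q.2‖ * k (q.1 - ξ q.2))
      ((volume : Measure ℂ).prod volume) := by
    refine (integrable_prod_iff' (hm.aestronglyMeasurable.comp_snd.norm.mul
      (hkm.comp hsub).aestronglyMeasurable)).2 ?_
    refine ⟨ae_of_all _ fun s => (hki.comp_sub_right (ξ s)).const_mul ‖m s‖, ?_⟩
    have h2 : (fun s => ∫ z : ℂ, ‖‖m s‖ * k (z - ξ s)‖) = fun s => ‖m s‖ * ∫ z, k z := by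
      ext s
      simp_rw [norm_mul, norm_norm, Real.norm_of_nonneg (hk0 _)]
      rw [integral_const_mul, integral_sub_right_eq_self k (ξ s)]
    change Integrable fun s => ∫ z : ℂ, ‖‖m s‖ * k (z - ξ s)‖
    rw [h2]
    exact hm.norm.mul_const _
  have h3 : Integrable (fun q : ℂ × ℝ => ‖m q.2‖ * k (q.1 - ξ q.2) + ‖m q.2‖)
      ((volume.restrict (Metric.ball (0 : ℂ) R)).prod volume) :=
    (h1.mono_measure (Measure.prod_mono Measure.restrict_le_self le_rfl)).add
      (hm.norm.comp_snd (volume.restrict (Metric.ball (0 : ℂ) R)))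
  refine h3.mono' ?_ (ae_of_all _ fun q => ?_)
  · simp_rw [div_eq_mul_inv]
    exact hm.aestronglyMeasurable.comp_snd.mul hsub.inv.aestronglyMeasurable
  · rw [norm_div, div_eq_mul_inv, ← mul_add_one]
    gcongr
    rcases lt_or_ge ‖q.1 - ξ q.2‖ 1 with h | h
    · have : k (q.1 - ξ q.2) = ‖q.1 - ξ q.2‖⁻¹ := indicator_of_mem (mem_Iio.2 h) _
      linarith
    · have := inv_le_one_of_one_le₀ h
      linarith [hk0 (q.1 - ξ q.2)]

theorem integrable_prod_of_norm_le {R : ℝ} {H : ℂ × ℝ → ℂ} (hH : Measurable H) {b : ℝ → ℝ}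
    (hb : Integrable b) (hle : ∀ z ∈ Metric.ball (0 : ℂ) R, ∀ s, ‖H (z, s)‖ ≤ b s) :
    Integrable H ((volume.restrict (Metric.ball (0 : ℂ) R)).prod volume) := by
  have hfin : IsFiniteMeasure ((volume : Measure ℂ).restrict (Metric.ball (0 : ℂ) R)) :=
    isFiniteMeasure_restrict.2 measure_ball_lt_top.ne
  refine (hb.comp_snd (volume.restrict (Metric.ball (0 : ℂ) R))).mono' hH.aestronglyMeasurable ?_
  rw [← Measure.restrict_univ (μ := (volume : Measure ℝ)), Measure.prod_restrict]
  filter_upwards [ae_restrict_mem (Metric.isOpen_ball.measurableSet.prod MeasurableSet.univ)]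
    with q hq
  exact hle q.1 hq.1 q.2

theorem integrable_dbarTwice_mul {φ : ℂ → ℝ} (hφ : ContDiff ℝ ∞ φ) (hc : HasCompactSupport φ)
    {U : Set ℂ} (hsupp : tsupport φ ⊆ U) {F : ℂ → ℂ} (hF : IntegrableOn F U) :
    Integrable (fun z => dbarTwice φ z * F z) := by
  obtain ⟨C, hC⟩ := (hasCompactSupport_dbarTwice hc).exists_bound_of_continuous
    (continuous_dbarTwice hφ)
  refine (integrableOn_iff_integrable_of_support_subset (s := U) fun z hz => ?_).1
    (Integrable.bdd_mul hF (continuous_dbarTwice hφ).aestronglyMeasurable (ae_of_all _ hC))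
  exact hsupp (support_dbarTwice_subset φ (left_ne_zero_of_mul hz))

/-- Fubini's theorem for pairing a superposition `∫ H z s ds` with `∂̄ φ`. -/
theorem integral_dbarTwice_mul_integral {φ : ℂ → ℝ} (hφ : ContDiff ℝ ∞ φ)
    (hc : HasCompactSupport φ) {R : ℝ} (hsupp : tsupport φ ⊆ Metric.ball 0 R) {H : ℂ → ℝ → ℂ}
    (hH : Integrable (fun q : ℂ × ℝ => H q.1 q.2)
      ((volume.restrict (Metric.ball (0 : ℂ) R)).prod volume)) :
    ∫ z, dbarTwice φ z * ∫ s, H z s = ∫ s, ∫ z, dbarTwice φ z * H z s := by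
  have h0 (F : ℂ → ℂ) :
      ∫ z in Metric.ball 0 R, dbarTwice φ z * F z = ∫ z, dbarTwice φ z * F z := by
    refine setIntegral_eq_integral_of_forall_compl_eq_zero fun z hz => ?_
    rw [Function.notMem_support.1 fun h => hz (hsupp (support_dbarTwice_subset φ h)), zero_mul]
  simp_rw [← h0, ← integral_const_mul]
  obtain ⟨C, hC⟩ := (hasCompactSupport_dbarTwice hc).exists_bound_of_continuous
    (continuous_dbarTwice hφ)
  refine integral_integral_swap (hH.bdd_mul (c := C) ?_ ?_)
  · exact ((continuous_dbarTwice hφ).comp continuous_fst).aestronglyMeasurable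
  · exact ae_of_all _ fun q => hC q.1

/-- A differentiable curve is a null set in the plane: it is the image of `w ↦ ξ (re w)`, whose
derivative is everywhere singular. -/
theorem volume_range_curve {ξ : ℝ → ℂ} (hξ : Differentiable ℝ ξ) :
    volume (range ξ) = 0 := by
  have h : (fun w : ℂ => ξ w.re) '' univ = range ξ := by
    ext z
    simp only [image_univ, mem_range]
    exact ⟨fun ⟨w, hw⟩ => ⟨w.re, hw⟩, fun ⟨s, hs⟩ => ⟨s, by simpa using hs⟩⟩
  rw [← h]
  refine addHaar_image_eq_zero_of_det_fderivWithin_eq_zero volume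
    (f' := fun w => (ContinuousLinearMap.toSpanSingleton ℝ (deriv ξ w.re)).comp Complex.reCLM) ?_ ?_
  · intro w _
    exact ((hξ w.re).hasDerivAt.hasFDerivAt.comp w
      Complex.reCLM.hasFDerivAt).hasFDerivWithinAt
  · intro w _
    by_contra hdet
    set f := (ContinuousLinearMap.toSpanSingleton ℝ (deriv ξ w.re)).comp Complex.reCLM
    have hI : LinearMap.equivOfDetNeZero (f : ℂ →ₗ[ℝ] ℂ) hdet Complex.I = 0 := by
      change f Complex.I = 0
      simp [f]
    exact Complex.I_ne_zero ((LinearEquiv.map_eq_zero_iff _).1 hI)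

/-! ### Principal values at infinity -/

theorem hasPVInfty_of_tendsto {g : ℝ → ℂ} {L : ℂ} (hg : LocallyIntegrable g volume)
    (h : ∀ x : ℝ, Tendsto (fun M : ℝ => ∫ s in (x - M)..(x + M), g s) atTop (𝓝 L)) :
    HasPVInfty g L :=
  ⟨hg, ⟨0, fun n => n, Nat.mono_cast, tendsto_natCast_atTop_atTop,
    (h 0).comp tendsto_natCast_atTop_atTop⟩,
    fun x _ _ _ hM hL => tendsto_nhds_unique hL ((h x).comp hM)⟩

theorem HasPVInfty.pvInfty_eq {g : ℝ → ℂ} {L : ℂ} (h : HasPVInfty g L) : pvInfty g = L := by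
  have hex : ∃ L, HasPVInfty g L := ⟨L, h⟩
  rw [pvInfty, dif_pos hex]
  obtain ⟨x, M, hM, hM', hL⟩ := hex.choose_spec.2.1
  exact h.2.2 x M _ hM hM' hL

/-- The function `1 / s`, truncated to `S < |s|`. It is odd, hence has principal value zero, and it
cancels the leading behaviour of `1 / (z - ξ s)` at infinity. -/
noncomputable def truncInv (S s : ℝ) : ℂ := (Icc (-S) S)ᶜ.indicator (fun t : ℝ => (t : ℂ)⁻¹) s

theorem truncInv_of_lt {S s : ℝ} (h : S < |s|) : truncInv S s = (s : ℂ)⁻¹ :=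
  indicator_of_mem (s := (Icc (-S) S)ᶜ)
    (mem_compl fun hs => not_le.2 h (abs_le.2 (mem_Icc.1 hs))) _

theorem truncInv_of_le {S s : ℝ} (h : |s| ≤ S) : truncInv S s = 0 :=
  indicator_of_notMem (s := (Icc (-S) S)ᶜ)
    (notMem_compl_iff.2 (mem_Icc.2 (abs_le.1 h))) _

theorem truncInv_neg (S s : ℝ) : truncInv S (-s) = -truncInv S s := by
  rcases le_or_gt |s| S with h | h
  · rw [truncInv_of_le h, truncInv_of_le (by rwa [abs_neg]), neg_zero]
  · rw [truncInv_of_lt h, truncInv_of_lt (by rwa [abs_neg])]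
    push_cast
    exact inv_neg

theorem norm_truncInv_le {S s b : ℝ} (hb : 0 < b) (h : b ≤ |s| ∨ b ≤ S) :
    ‖truncInv S s‖ ≤ b⁻¹ := by
  rcases le_or_gt |s| S with h1 | h1
  · rw [truncInv_of_le h1, norm_zero]; positivity
  · rw [truncInv_of_lt h1, norm_inv, Complex.norm_real, Real.norm_eq_abs]
    have : b ≤ |s| := h.elim id fun h => h.trans h1.le
    gcongr

theorem measurable_truncInv (S : ℝ) : Measurable (truncInv S) := by
  unfold truncInv
  exact (by fun_prop : Measurable fun t : ℝ => (t : ℂ)⁻¹).indicator measurableSet_Icc.compl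

theorem intervalIntegrable_truncInv {S : ℝ} (hS : 0 < S) (x y : ℝ) :
    IntervalIntegrable (truncInv S) volume x y := by
  refine (intervalIntegrable_const (c := S⁻¹)).mono_fun
    (measurable_truncInv S).aestronglyMeasurable (ae_of_all _ fun s => ?_)
  rw [Real.norm_of_nonneg (by positivity)]
  exact norm_truncInv_le hS (Or.inr le_rfl)

/-- The integral over the interval of radius `M` around `x` reduces by oddness to one over
`[M - x, M + x]`, whose length stays bounded while the integrand tends to zero. -/
theorem tendsto_integral_truncInv {S : ℝ} (hS : 0 < S) (x : ℝ) :
    Tendsto (fun M : ℝ => ∫ s in (x - M)..(x + M), truncInv S s) atTop (𝓝 0) := by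
  have hodd : ∀ b : ℝ, ∫ s in (-b)..b, truncInv S s = 0 := by
    intro b
    have h := intervalIntegral.integral_comp_neg (a := -b) (b := b) (truncInv S)
    simp only [truncInv_neg, intervalIntegral.integral_neg, neg_neg] at h
    exact self_eq_neg.1 h.symm
  have h1 : Tendsto (fun M : ℝ => (M - |x|)⁻¹ * |2 * x|) atTop (𝓝 0) := by
    simpa [← sub_eq_add_neg] using (tendsto_inv_atTop_zero.comp
      (tendsto_atTop_add_const_right atTop (-|x|) tendsto_id)).mul_const |2 * x|
  refine squeeze_zero_norm' ?_ h1
  filter_upwards [eventually_gt_atTop |x|] with M hM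
  have h2 : ∫ s in (x - M)..(x + M), truncInv S s = ∫ s in (M - x)..(x + M), truncInv S s := by
    rw [← intervalIntegral.integral_add_adjacent_intervals (b := M - x)
      (intervalIntegrable_truncInv hS _ _) (intervalIntegrable_truncInv hS _ _)]
    have := hodd (M - x)
    rw [neg_sub] at this
    rw [this, zero_add]
  rw [h2]
  have h3 := intervalIntegral.norm_integral_le_of_norm_le_const (a := M - x) (b := x + M)
    (f := truncInv S) (C := (M - |x|)⁻¹) ?_
  · convert h3 using 3; ring
  · intro s hs
    refine norm_truncInv_le (sub_pos.2 hM) (Or.inl ?_)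
    have h4 : M - |x| ≤ s := by
      refine le_trans ?_ hs.1.le
      have := le_abs_self x
      have := neg_abs_le x
      exact le_min (by linarith) (by linarith)
    exact h4.trans (le_abs_self s)

/-! ### Integration by parts against a primitive -/

theorem hasCompactSupport_of_le_abs {E : Type*} [Zero E] {f : ℝ → E} {T : ℝ}
    (hf : ∀ s, T ≤ |s| → f s = 0) : HasCompactSupport f :=
  HasCompactSupport.intro (isCompact_Icc (a := -T) (b := T)) fun s hs => hf s (by
    by_contra! h
    exact hs (abs_le.1 h.le))

theorem continuous_of_integral_eq {g G : ℝ → ℝ} (hg : LocallyIntegrable g volume)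
    (hG : ∀ x y, ∫ s in x..y, g s = G y - G x) : Continuous G := by
  have h : G = fun y => G 0 + ∫ s in (0 : ℝ)..y, g s := by
    ext y; rw [hG]; ring
  rw [h]
  exact continuous_const.add (intervalIntegral.continuous_primitive (fun x y =>
    (hg.integrableOn_isCompact isCompact_uIcc).intervalIntegrable) 0)

/-- Integration by parts `∫ (h G)' = 0`, where `G` is merely absolutely continuous. -/
theorem integral_mul_add_deriv_mul_primitive {g G : ℝ → ℝ} (hg : LocallyIntegrable g volume)
    (hG : ∀ x y, ∫ s in x..y, g s = G y - G x) {h h' : ℝ → ℝ} (hd : ∀ s, HasDerivAt h (h' s) s)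
    (hc : Continuous h') {T : ℝ} (hs : ∀ s, T ≤ |s| → h s = 0)
    (hs' : ∀ s, T ≤ |s| → h' s = 0) :
    ∫ s, (h s * g s + h' s * G s) = 0 := by
  have hGc := continuous_of_integral_eq hg hG
  have hgi : ∀ x y, IntervalIntegrable g volume x y := fun x y =>
    (hg.integrableOn_isCompact isCompact_uIcc).intervalIntegrable
  have hhc : Continuous h := continuous_iff_continuousAt.2 fun s => (hd s).continuousAt
  have hacG : AbsolutelyContinuousOnInterval G (-T) T := by
    have h1 := (hgi (-T) T).absolutelyContinuousOnInterval_intervalIntegral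
      (c := -T) (by simp)
    have h2 : G = fun y => (∫ s in (-T)..y, g s) + G (-T) := by
      ext y; rw [hG]; ring
    rw [h2]
    have h3 : AbsolutelyContinuousOnInterval (fun _ : ℝ => G (-T)) (-T) T :=
      (LipschitzWith.const (G (-T))).lipschitzOnWith.absolutelyContinuousOnInterval
    exact h1.add h3
  have hach : AbsolutelyContinuousOnInterval h (-T) T := by
    refine ContDiffOn.absolutelyContinuousOnInterval ?_
    refine ContDiff.contDiffOn ?_
    rw [contDiff_one_iff_deriv]
    refine ⟨fun s => (hd s).differentiableAt, ?_⟩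
    rwa [show deriv h = h' from funext fun s => (hd s).deriv]
  have hdG : ∀ᵐ s, deriv G s = g s := by
    filter_upwards [LocallyIntegrable.ae_hasDerivAt_integral hg] with s h1
    have h2 := (h1 0).const_add (G 0)
    have h3 : G = fun y => G 0 + ∫ s in (0 : ℝ)..y, g s := by
      ext y; rw [hG]; ring
    rw [h3]
    exact h2.deriv
  have key := hach.integral_mul_deriv_eq_deriv_mul hacG
  rw [hs T (le_abs_self T), hs (-T) (by rw [abs_neg]; exact le_abs_self T),
    intervalIntegral.integral_congr_ae (g := fun s => h s * g s)
      (hdG.mono fun s hs _ => by rw [hs])] at key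
  rw [show deriv h = h' from funext fun s => (hd s).deriv] at key
  have hsub : Function.support (fun s => h s * g s + h' s * G s) ⊆ Ioc (-T) T := by
    intro s hs1
    by_contra h2
    apply hs1
    have : T ≤ |s| := by
      by_contra! h3
      exact h2 ⟨(abs_lt.1 h3).1, (abs_lt.1 h3).2.le⟩
    simp [hs s this, hs' s this]
  rw [← intervalIntegral.integral_eq_integral_of_support_subset hsub,
    intervalIntegral.integral_add ((hgi _ _).continuousOn_mul hhc.continuousOn)
      ((show Continuous fun s => h' s * G s from hc.mul hGc).intervalIntegrable _ _), key]
  ring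

/-- Integration by parts for complex `h`, from the real and imaginary parts. -/
theorem integral_complex_mul_add_deriv_mul_primitive {g G : ℝ → ℝ}
    (hg : LocallyIntegrable g volume)
    (hG : ∀ x y, ∫ s in x..y, g s = G y - G x) {h h' : ℝ → ℂ} (hd : ∀ s, HasDerivAt h (h' s) s)
    (hc : Continuous h') {T : ℝ} (hs : ∀ s, T ≤ |s| → h s = 0)
    (hs' : ∀ s, T ≤ |s| → h' s = 0) :
    ∫ s, (h s * g s + h' s * G s) = 0 := by
  have hGc := continuous_of_integral_eq hg hG
  have hhc : Continuous h := continuous_iff_continuousAt.2 fun s => (hd s).continuousAt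
  have hi : Integrable (fun s => h s * g s + h' s * G s) := by
    refine Integrable.add ?_ ?_
    · have := (hg.integrable_smul_right_of_hasCompactSupport hhc (hasCompactSupport_of_le_abs hs))
      refine this.congr (ae_of_all _ fun s => ?_)
      simp [mul_comm]
    · refine Continuous.integrable_of_hasCompactSupport
        (hc.mul (Complex.continuous_ofReal.comp hGc)) ((hasCompactSupport_of_le_abs hs').mul_right)
  apply Complex.ext
  · rw [← Complex.reCLM_apply, ← ContinuousLinearMap.integral_comp_comm _ hi]
    have := integral_mul_add_deriv_mul_primitive hg hG (h := fun s => (h s).re)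
      (h' := fun s => (h' s).re)
      (fun s => Complex.reCLM.hasFDerivAt.comp_hasDerivAt s (hd s)) (by fun_prop) (T := T)
      (fun s h1 => by simp [hs s h1]) (fun s h1 => by simp [hs' s h1])
    simpa using this
  · rw [← Complex.imCLM_apply, ← ContinuousLinearMap.integral_comp_comm _ hi]
    have := integral_mul_add_deriv_mul_primitive hg hG (h := fun s => (h s).im)
      (h' := fun s => (h' s).im)
      (fun s => Complex.imCLM.hasFDerivAt.comp_hasDerivAt s (hd s)) (by fun_prop) (T := T)
      (fun s h1 => by simp [hs s h1]) (fun s h1 => by simp [hs' s h1])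
    simpa using this

/-! ### Near and far parts of the sheet -/

/-- `S` is so large that the part `S ≤ |s|` of the curve stays away, linearly in `|s|`, from the
ball of radius `R` around the origin. The condition `2 ≤ κ * S` gives distance at least `2`, so that
every cutoff `a (|z - ξ s|²)` vanishes there. -/
structure IsFarRadius (ξ : ℝ → ℂ) (R κ S : ℝ) : Prop where
  pos : 0 < κ
  one_le : 1 ≤ S
  two_le : 2 ≤ κ * S
  le_norm : ∀ z ∈ Metric.ball (0 : ℂ) R, ∀ s, S ≤ |s| → κ * |s| ≤ ‖z - ξ s‖

theorem ChordArc.exists_isFarRadius {ξ : ℝ → ℂ} (h : ChordArc ξ) (R S₀ : ℝ) :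
    ∃ κ S : ℝ, S₀ ≤ S ∧ IsFarRadius ξ R κ S := by
  obtain ⟨K, hK, h⟩ := h
  refine ⟨K / 2, max (max S₀ 1) (max (4 / K) (2 * (‖ξ 0‖ + R) / K)), by simp, by positivity,
    by simp, ?_, ?_⟩
  · have : 4 / K ≤ max (max S₀ 1) (max (4 / K) (2 * (‖ξ 0‖ + R) / K)) := by simp
    rw [div_le_iff₀ hK] at this
    linarith
  · intro z hz s hs
    have h1 : 2 * (‖ξ 0‖ + R) / K ≤ |s| := le_trans (by simp) hs
    rw [div_le_iff₀ hK] at h1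
    have h2 := h s 0
    rw [sub_zero] at h2
    have h3 : ‖z‖ < R := by simpa using hz
    have h4 : ‖ξ s - ξ 0‖ ≤ ‖z - ξ s‖ + ‖z‖ + ‖ξ 0‖ := by
      calc ‖ξ s - ξ 0‖ = ‖-(z - ξ s) + z - ξ 0‖ := by congr 1; ring
        _ ≤ ‖-(z - ξ s) + z‖ + ‖ξ 0‖ := norm_sub_le _ _
        _ ≤ ‖-(z - ξ s)‖ + ‖z‖ + ‖ξ 0‖ := by gcongr; exact norm_add_le _ _
        _ = _ := by rw [norm_neg]
    linarith

/-- A `C¹` cutoff in the curve parameter, equal to `1` on `[-S, S]` and to `0` off `[-(S+1), S+1]`.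
Unlike `a (|z - ξ s|²)`, it does not depend on `z`. -/
structure IsPlateau (χ : ℝ → ℝ) (S : ℝ) : Prop where
  smooth : ContDiff ℝ 1 χ
  nonneg : ∀ s, 0 ≤ χ s
  le_one : ∀ s, χ s ≤ 1
  eq_one : ∀ s, |s| ≤ S → χ s = 1
  eq_zero : ∀ s, S + 1 ≤ |s| → χ s = 0

theorem exists_isPlateau {S : ℝ} (hS : 0 < S) : ∃ χ, IsPlateau χ S := by
  let f : ContDiffBump (0 : ℝ) := ⟨S, S + 1, hS, by linarith⟩
  refine ⟨f, f.contDiff, fun _ => f.nonneg, fun _ => f.le_one, fun s hs => ?_, fun s hs => ?_⟩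
  · exact f.one_of_mem_closedBall (by simpa using hs)
  · exact f.zero_of_le_dist (by simpa using hs)

theorem IsPlateau.deriv_eq_zero_of_lt {χ : ℝ → ℝ} {S : ℝ} (h : IsPlateau χ S) {s : ℝ}
    (hs : |s| < S) : deriv χ s = 0 := by
  have : χ =ᶠ[𝓝 s] fun _ => 1 := by
    filter_upwards [(isOpen_lt continuous_abs continuous_const).mem_nhds hs] with t ht
    exact h.eq_one t (le_of_lt ht)
  simp [this.deriv_eq]

theorem IsPlateau.deriv_eq_zero_of_gt {χ : ℝ → ℝ} {S : ℝ} (h : IsPlateau χ S) {s : ℝ}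
    (hs : S + 1 < |s|) : deriv χ s = 0 := by
  have : χ =ᶠ[𝓝 s] fun _ => 0 := by
    filter_upwards [(isOpen_lt continuous_const continuous_abs).mem_nhds hs] with t ht
    exact h.eq_zero t (le_of_lt ht)
  simp [this.deriv_eq]

theorem IsPlateau.hasCompactSupport {χ : ℝ → ℝ} {S : ℝ} (h : IsPlateau χ S) :
    HasCompactSupport χ :=
  hasCompactSupport_of_le_abs h.eq_zero

theorem IsCutoff.deriv_eq_zero {a : ℝ → ℝ} (h : IsCutoff a) {s : ℝ} (hs : 2 < |s|) :
    deriv a s = 0 := by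
  have : a =ᶠ[𝓝 s] fun _ => 0 := by
    filter_upwards [(isOpen_lt continuous_const continuous_abs).mem_nhds hs] with t ht
    exact h.eq_zero t (le_of_lt ht)
  simp [this.deriv_eq]

/-- The compactly supported density `χ (γ - c) + χ' Γ + c 1_{[-S, S]}`, whose Cauchy integral is the
singular part of the velocity. It equals `γ` on `(-S, S)`. -/
noncomputable def nearDensity (χ : ℝ → ℝ) (S : ℝ) (γ : ℝ → ℝ) (c : ℝ) (Γ : ℝ → ℝ) (s : ℝ) : ℂ :=
  ((χ s * (γ s - c) + deriv χ s * Γ s + if |s| ≤ S then c else 0 : ℝ) : ℂ)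

/-- The contribution of `S < |s|` to the constant part of the strength, regularized by `1 / s` so
that it is absolutely integrable. -/
noncomputable def farCauchyKernel (S : ℝ) (ξ : ℝ → ℂ) (c : ℝ) (z : ℂ) (s : ℝ) : ℂ :=
  if |s| ≤ S then 0 else c * (1 / (z - ξ s) + (s : ℂ)⁻¹)

/-- The far part of `(γ - c) / (z - ξ)` after integration by parts, up to sign: the growth of `Γ` is
sublinear, so that the kernel is absolutely integrable. -/
noncomputable def farDipoleKernel (χ : ℝ → ℝ) (ξ : ℝ → ℂ) (Γ : ℝ → ℝ) (z : ℂ) (s : ℝ) : ℂ :=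
  ((1 - χ s : ℝ) : ℂ) * deriv ξ s * Γ s / (z - ξ s) ^ 2

theorem farDipoleKernel_of_le {χ : ℝ → ℝ} {S : ℝ} (hχ : IsPlateau χ S) (ξ : ℝ → ℂ) (Γ : ℝ → ℝ)
    (z : ℂ) {s : ℝ} (hs : |s| ≤ S) : farDipoleKernel χ ξ Γ z s = 0 := by
  simp [farDipoleKernel, hχ.eq_one s hs]

theorem measurable_farCauchyKernel (S : ℝ) {ξ : ℝ → ℂ} (hξ : Measurable ξ) (c : ℝ) :
    Measurable fun q : ℂ × ℝ => farCauchyKernel S ξ c q.1 q.2 := by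
  refine Measurable.ite ?_ measurable_const (by fun_prop)
  exact measurableSet_le (by fun_prop) measurable_const

theorem measurable_farDipoleKernel {χ : ℝ → ℝ} {ξ : ℝ → ℂ} {Γ : ℝ → ℝ}
    (hχ : Measurable χ) (hξ : Measurable ξ) (hΓ : Measurable Γ) :
    Measurable fun q : ℂ × ℝ => farDipoleKernel χ ξ Γ q.1 q.2 := by
  have hd : Measurable (deriv ξ) := measurable_deriv ξ
  unfold farDipoleKernel
  fun_prop

theorem integrable_nearDensity {χ : ℝ → ℝ} {S : ℝ} {γ : ℝ → ℝ} {c : ℝ} {Γ : ℝ → ℝ}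
    (hχ : IsPlateau χ S) (hA : IsSublinearPrimitive γ c Γ) :
    Integrable (nearDensity χ S γ c Γ) := by
  have hg : LocallyIntegrable (fun s => γ s - c) volume :=
    hA.locallyIntegrable.sub (continuous_const.locallyIntegrable)
  have hΓ : Continuous Γ := continuous_of_integral_eq hg hA.integral_eq
  refine Integrable.ofReal (Integrable.add (Integrable.add ?_ ?_) ?_)
  · exact hg.integrable_smul_left_of_hasCompactSupport hχ.smooth.continuous hχ.hasCompactSupport
  · exact ((hχ.smooth.continuous_deriv le_rfl).mul hΓ).integrable_of_hasCompactSupport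
      (hχ.hasCompactSupport.deriv.mul_right)
  · have h : Integrable ((Icc (-S) S).indicator fun _ : ℝ => c) :=
      (integrable_indicator_iff measurableSet_Icc).2
        (integrableOn_const (by simp))
    refine h.congr (ae_of_all _ fun s => ?_)
    simp [indicator, abs_le]

/-! ### Integrable bounds for the far kernels -/

/-- The power `|s| ^ p`, restricted to `S < |s|`. -/
noncomputable def tailPow (S p s : ℝ) : ℝ := (Ioi S).indicator (fun r : ℝ => r ^ p) |s|

theorem tailPow_of_le {S s : ℝ} (p : ℝ) (h : |s| ≤ S) : tailPow S p s = 0 :=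
  indicator_of_notMem (by simpa using h) _

theorem tailPow_of_lt {S s : ℝ} (p : ℝ) (h : S < |s|) : tailPow S p s = |s| ^ p :=
  indicator_of_mem (by simpa using h) _

theorem tailPow_nonneg (S p s : ℝ) : 0 ≤ tailPow S p s := by
  rcases le_or_gt |s| S with h | h
  · rw [tailPow_of_le p h]
  · rw [tailPow_of_lt p h]; positivity

theorem integrable_tailPow {S p : ℝ} (hS : 0 < S) (hp : p < -1) : Integrable (tailPow S p) := by
  have h := integrable_fun_norm_addHaar (μ := (volume : Measure ℝ))
    (f := (Ioi S).indicator (fun r : ℝ => r ^ p))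
  simp only [Real.norm_eq_abs, Module.finrank_self, Nat.sub_self, pow_zero, one_smul] at h
  refine h.2 ?_
  exact ((integrable_indicator_iff measurableSet_Ioi).2
    (integrableOn_Ioi_rpow_of_lt hp hS)).integrableOn

/-- Since `1 / (z - ξ s) + 1 / s = (z - (ξ s - s)) / ((z - ξ s) s)`, the kernel is bounded by a
multiple of `(R + |ξ s - s|) / s²`. The bounded part of `ξ s - s` is harmless here, and the square
integrable part is paired with the square integrable function `1 / s²`. -/
theorem exists_integrable_farCauchyKernel_bound {ξ : ℝ → ℂ} (hξ : Continuous ξ) (c : ℝ)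
    {R κ S : ℝ} (hS : IsFarRadius ξ R κ S)
    (hdecomp : ∃ f₁ f₂ : ℝ → ℂ, MemLp f₁ 2 volume ∧ MemLp f₂ ∞ volume ∧
      ∀ α : ℝ, ξ α - (α : ℂ) = f₁ α + f₂ α) :
    ∃ b : ℝ → ℝ, Integrable b ∧ ∀ z ∈ Metric.ball (0 : ℂ) R, ∀ s,
      ‖farCauchyKernel S ξ c z s‖ ≤ b s := by
  have hκ := hS.pos
  have hS0 : 0 < S := zero_lt_one.trans_le hS.one_le
  -- the deviation of the curve from the real line, weighted by `s⁻²`, is integrable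
  have hdev : Integrable fun s => tailPow S (-2) s * ‖ξ s - s‖ := by
    obtain ⟨f₁, f₂, h1, h2, h12⟩ := hdecomp
    have hB : ∀ᵐ s, ‖f₂ s‖ ≤ (eLpNormEssSup f₂ volume).toReal := by
      have hlt : eLpNormEssSup f₂ volume < (∞ : ℝ≥0∞) := by
        have := h2.2
        rwa [eLpNorm_exponent_top] at this
      filter_upwards [enorm_ae_le_eLpNormEssSup f₂ volume] with s hs
      rw [← toReal_enorm]
      exact ENNReal.toReal_mono hlt.ne hs
    set B := (eLpNormEssSup f₂ volume).toReal
    have hsq : Integrable fun s => ‖f₁ s‖ ^ 2 := h1.integrable_norm_pow (by norm_num)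
    refine ((hsq.add (integrable_tailPow hS0 (p := -4) (by norm_num))).add
      ((integrable_tailPow hS0 (p := -2) (by norm_num)).mul_const B)).mono' ?_ ?_
    · exact (integrable_tailPow hS0 (p := -2) (by norm_num)).aestronglyMeasurable.mul
        (by fun_prop : Continuous fun s : ℝ => ‖ξ s - s‖).aestronglyMeasurable
    · filter_upwards [hB] with s hs
      rw [norm_mul, norm_norm, Real.norm_of_nonneg (tailPow_nonneg _ _ _), h12]
      have h3 : tailPow S (-4) s = tailPow S (-2) s ^ 2 := by
        rcases le_or_gt |s| S with h | h
        · simp [tailPow_of_le _ h]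
        · rw [tailPow_of_lt _ h, tailPow_of_lt _ h, ← Real.rpow_natCast,
            ← Real.rpow_mul (abs_nonneg s)]
          norm_num
      simp only [Pi.add_apply]
      rw [h3]
      have h4 : tailPow S (-2) s * ‖f₁ s + f₂ s‖ ≤ tailPow S (-2) s * (‖f₁ s‖ + B) :=
        mul_le_mul_of_nonneg_left ((norm_add_le _ _).trans (by gcongr)) (tailPow_nonneg _ _ _)
      -- Young's inequality for `s⁻² * |f₁ s|`, as the square of `s⁻²` is `s⁻⁴`
      nlinarith [sq_nonneg (tailPow S (-2) s - ‖f₁ s‖), sq_nonneg (tailPow S (-2) s + ‖f₁ s‖)]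
  refine ⟨fun s => |c| / κ * (R * tailPow S (-2) s + tailPow S (-2) s * ‖ξ s - s‖),
    (((integrable_tailPow hS0 (by norm_num)).const_mul R).add hdev).const_mul _, fun z hz s => ?_⟩
  rcases le_or_gt |s| S with h | h
  · simp [farCauchyKernel, h, tailPow_of_le]
  have hs0 : 0 < |s| := hS0.trans h
  have hD := hS.le_norm z hz s h.le
  have hD0 : 0 < ‖z - ξ s‖ := lt_of_lt_of_le (by positivity) hD
  have hsne : (s : ℂ) ≠ 0 := by exact_mod_cast abs_pos.1 hs0
  have hDne : z - ξ s ≠ 0 := norm_pos_iff.1 hD0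
  rw [farCauchyKernel, if_neg h.not_ge]
  simp only [tailPow_of_lt _ h]
  have e : (c : ℂ) * (1 / (z - ξ s) + (s : ℂ)⁻¹) = c * ((z - (ξ s - s)) / ((z - ξ s) * s)) := by
    field_simp
    ring
  have hz' : ‖z‖ ≤ R := (mem_ball_zero_iff.1 hz).le
  rw [e, norm_mul, norm_div, norm_mul, Complex.norm_real, Complex.norm_real, Real.norm_eq_abs,
    Real.norm_eq_abs]
  calc |c| * (‖z - (ξ s - s)‖ / (‖z - ξ s‖ * |s|))
      ≤ |c| * ((R + ‖ξ s - s‖) / (κ * |s| * |s|)) := by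
        have h3 : ‖z - (ξ s - s)‖ ≤ R + ‖ξ s - s‖ :=
          (norm_sub_le z (ξ s - s)).trans (add_le_add_left hz' _)
        have h4 : 0 ≤ R + ‖ξ s - s‖ := (norm_nonneg _).trans h3
        gcongr
    _ = |c| / κ * (R * |s| ^ (-2 : ℝ) + |s| ^ (-2 : ℝ) * ‖ξ s - s‖) := by
        rw [Real.rpow_neg hs0.le, show (2 : ℝ) = ((2 : ℕ) : ℝ) by norm_num, Real.rpow_natCast]
        field_simp

/-- The kernel is of order `|s| ^ (β - 2)` at infinity, where `β < 1`. -/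
theorem exists_integrable_farDipoleKernel_bound {ξ : ℝ → ℂ} {γ : ℝ → ℝ} {c : ℝ}
    {Γ : ℝ → ℝ} (hA : IsSublinearPrimitive γ c Γ) {M : ℝ} (hM : ∀ s, ‖deriv ξ s‖ ≤ M) :
    ∃ S₀ : ℝ, ∀ (χ : ℝ → ℝ) (R κ S : ℝ), S₀ ≤ S → IsFarRadius ξ R κ S → IsPlateau χ S →
      ∃ b : ℝ → ℝ, Integrable b ∧ ∀ z ∈ Metric.ball (0 : ℂ) R, ∀ s,
        ‖farDipoleKernel χ ξ Γ z s‖ ≤ b s := by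
  obtain ⟨ε, hε, C, hC, β, hβ0, hβ1, hgrowth⟩ := hA.growth
  refine ⟨ε, fun χ R κ S hεS hS hχ => ?_⟩
  have hκ := hS.pos
  have hS0 : 0 < S := zero_lt_one.trans_le hS.one_le
  refine ⟨fun s => M * C / κ ^ 2 * tailPow S (β - 2) s,
    (integrable_tailPow hS0 (by linarith)).const_mul _, fun z hz s => ?_⟩
  rcases le_or_gt |s| S with h | h
  · simp [farDipoleKernel_of_le hχ, h, tailPow_of_le]
  have hs0 : 0 < |s| := hS0.trans h
  have hD := hS.le_norm z hz s h.le
  have hD0 : 0 < ‖z - ξ s‖ := lt_of_lt_of_le (by positivity) hD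
  rw [farDipoleKernel]
  simp only [tailPow_of_lt _ h]
  have hM0 : 0 ≤ M := (norm_nonneg _).trans (hM s)
  have hΓ : |Γ s| ≤ C * |s| ^ β := by
    have := hgrowth s (hεS.trans_lt h)
    rwa [div_le_iff₀ (by positivity)] at this
  have hχ1 : |1 - χ s| ≤ 1 := by
    rw [abs_le]
    constructor <;> linarith [hχ.nonneg s, hχ.le_one s]
  rw [norm_div, norm_mul, norm_mul, norm_pow, Complex.norm_real, Complex.norm_real,
    Real.norm_eq_abs, Real.norm_eq_abs]
  calc |1 - χ s| * ‖deriv ξ s‖ * |Γ s| / ‖z - ξ s‖ ^ 2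
      ≤ 1 * M * (C * |s| ^ β) / (κ * |s|) ^ 2 := by
        gcongr
        exact hM s
    _ = M * C / κ ^ 2 * |s| ^ (β - 2) := by
        rw [Real.rpow_sub hs0, show (2 : ℝ) = ((2 : ℕ) : ℝ) by norm_num, Real.rpow_natCast]
        field_simp

/-! ### Representation of the velocity -/

/-- An absolutely integrable kernel whose integral over `s` is `2πi (u - iv)`, for `z` in a ball
that is far from the part `S < |s|` of the curve. -/
noncomputable def velocityKernel (χ : ℝ → ℝ) (S : ℝ) (ξ : ℝ → ℂ) (γ : ℝ → ℝ) (c : ℝ) (Γ : ℝ → ℝ)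
    (z : ℂ) (s : ℝ) : ℂ :=
  nearDensity χ S γ c Γ s / (z - ξ s) + (farCauchyKernel S ξ c z s - farDipoleKernel χ ξ Γ z s)

/-- The far kernels are holomorphic in `z` on the ball, so that only the Cauchy kernel of the near
density contributes. Where `φ ∘ ξ` does not vanish, that density is `γ`. -/
theorem integral_dbarTwice_mul_velocityKernel {χ : ℝ → ℝ} {S R κ : ℝ} {ξ : ℝ → ℂ} {γ : ℝ → ℝ}
    {c : ℝ} {Γ : ℝ → ℝ} (hS : IsFarRadius ξ R κ S) (hχ : IsPlateau χ S)
    {φ : ℂ → ℝ} (hφ : ContDiff ℝ ∞ φ) (hc : HasCompactSupport φ)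
    (hsupp : tsupport φ ⊆ Metric.ball 0 R) {s : ℝ}
    (h₁ : IntegrableOn (fun z => nearDensity χ S γ c Γ s / (z - ξ s)) (Metric.ball 0 R))
    (h₂ : IntegrableOn (fun z => farCauchyKernel S ξ c z s - farDipoleKernel χ ξ Γ z s)
      (Metric.ball 0 R)) :
    ∫ z, dbarTwice φ z * velocityKernel χ S ξ γ c Γ z s
      = -(2 * Real.pi) * ((γ s * φ (ξ s) : ℝ) : ℂ) := by
  have hfar : ∫ z, dbarTwice φ z * (farCauchyKernel S ξ c z s - farDipoleKernel χ ξ Γ z s) = 0 := by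
    rcases le_or_gt |s| S with h | h
    · simp [farCauchyKernel, farDipoleKernel_of_le hχ, h]
    · refine integral_dbarTwice_mul_of_holomorphic hφ hc Metric.isOpen_ball hsupp ?_
      simp only [farCauchyKernel, farDipoleKernel, if_neg h.not_ge]
      have hne : ∀ z ∈ Metric.ball (0 : ℂ) R, z - ξ s ≠ 0 := fun z hz => by
        have h1 := hS.le_norm z hz s h.le
        have h2 : 0 < κ * |s| := mul_pos hS.pos ((zero_lt_one.trans_le hS.one_le).trans h)
        exact norm_pos_iff.1 (h2.trans_le h1)
      have hne2 : ∀ z ∈ Metric.ball (0 : ℂ) R, (z - ξ s) ^ 2 ≠ 0 := fun z hz =>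
        pow_ne_zero 2 (hne z hz)
      fun_prop (disch := assumption)
  have hnear : ∫ z, dbarTwice φ z * (nearDensity χ S γ c Γ s / (z - ξ s)) =
      nearDensity χ S γ c Γ s * (-(2 * Real.pi) * φ (ξ s)) := by
    rw [← integral_dbarTwice_div_sub hφ hc (ξ s), ← integral_const_mul]
    congr 1; ext z; ring
  simp only [velocityKernel, mul_add]
  rw [integral_add (integrable_dbarTwice_mul hφ hc hsupp h₁)
    (integrable_dbarTwice_mul hφ hc hsupp h₂), hfar, hnear, add_zero]
  by_cases h0 : φ (ξ s) = 0
  · simp [h0]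
  · have hmem : ξ s ∈ Metric.ball (0 : ℂ) R := hsupp (subset_tsupport φ h0)
    have hs : |s| < S := by
      by_contra! h
      have h1 := hS.le_norm _ hmem s h
      have h2 : 0 < κ * |s| := mul_pos hS.pos ((zero_lt_one.trans_le hS.one_le).trans_le h)
      rw [sub_self, norm_zero] at h1
      linarith
    rw [nearDensity, hχ.eq_one s hs.le, hχ.deriv_eq_zero_of_lt hs, if_pos hs.le]
    push_cast
    ring

theorem integrable_div_sub_curve {m : ℝ → ℂ} (hm : Integrable m) {ξ : ℝ → ℂ} (hξ : Continuous ξ)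
    {R κ S : ℝ} (hS : IsFarRadius ξ R κ S) {z : ℂ} (hz : z ∈ Metric.ball (0 : ℂ) R)
    (hzξ : z ∉ range ξ) : Integrable fun s => m s / (z - ξ s) := by
  have hne : ∀ s, z - ξ s ≠ 0 := fun s h => hzξ ⟨s, (sub_eq_zero.1 h).symm⟩
  have hcont : Continuous fun s => (z - ξ s)⁻¹ := (continuous_const.sub hξ).inv₀ hne
  obtain ⟨C, hC⟩ := (isCompact_Icc (a := -S) (b := S)).exists_bound_of_continuousOn
    hcont.continuousOn
  simp_rw [div_eq_inv_mul]
  refine hm.bdd_mul (c := max C 1) hcont.aestronglyMeasurable (ae_of_all _ fun s => ?_)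
  rcases le_or_gt |s| S with h | h
  · exact (hC s (abs_le.1 h)).trans (le_max_left _ _)
  · refine le_trans ?_ (le_max_right _ _)
    rw [norm_inv]
    apply inv_le_one_of_one_le₀
    have h1 := hS.le_norm z hz s h.le
    have h2 : κ * S ≤ κ * |s| := mul_le_mul_of_nonneg_left h.le hS.pos.le
    linarith [hS.two_le]

/-- The principal value of `∫ c / (z - ξ)` is the absolutely convergent integral of
`c / (z - ξ s) + c / s`, with `1 / s` truncated: for every centre the symmetric integrals of the
added term tend to zero. -/
theorem hasPVInfty_integrand₀ {ξ : ℝ → ℂ} (hξ : Continuous ξ) {c S : ℝ} (hS : 0 < S) {z : ℂ}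
    (hz : z ∉ range ξ)
    (hi : Integrable fun s => integrand₀ ξ c z s + c * truncInv S s) :
    HasPVInfty (integrand₀ ξ c z) (∫ s, (integrand₀ ξ c z s + c * truncInv S s)) := by
  have hne : ∀ s, z - ξ s ≠ 0 := fun s h => hz ⟨s, (sub_eq_zero.1 h).symm⟩
  have hcont : Continuous (integrand₀ ξ c z) := continuous_const.div (continuous_const.sub hξ) hne
  refine hasPVInfty_of_tendsto hcont.locallyIntegrable fun x => ?_
  have h1 : Tendsto (fun M : ℝ => ∫ s in (x - M)..(x + M), (integrand₀ ξ c z s + c * truncInv S s))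
      atTop (𝓝 (∫ s, (integrand₀ ξ c z s + c * truncInv S s))) := by
    refine intervalIntegral_tendsto_integral hi ?_ ?_
    · exact tendsto_atBot_add_const_left atTop x tendsto_neg_atTop_atBot
    · exact tendsto_atTop_add_const_left atTop x tendsto_id
  have h2 := h1.sub ((tendsto_integral_truncInv hS x).const_mul (c : ℂ))
  rw [mul_zero, sub_zero] at h2
  refine h2.congr fun M => ?_
  rw [intervalIntegral.integral_add (hcont.intervalIntegrable _ _)
    ((intervalIntegrable_truncInv hS _ _).const_mul _), intervalIntegral.integral_const_mul,
    add_sub_cancel_right]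

/-- The regularized velocity does not change if its cutoff `a (|z - ξ s|²)` is replaced by the
cutoff `χ s` in the parameter: the two integrands differ by the derivative of
`(a (|z - ξ|²) - χ) Γ / (z - ξ)`, which is absolutely continuous and compactly supported. -/
theorem sheetVelocity_eq_integral_velocityKernel {χ : ℝ → ℝ} {S R κ : ℝ} {ξ : ℝ → ℂ} {γ : ℝ → ℝ}
    {c : ℝ} {Γ : ℝ → ℝ} {a : ℝ → ℝ} (ha : IsCutoff a) (hξ : ContDiff ℝ 2 ξ)
    (hA : IsSublinearPrimitive γ c Γ) (hS : IsFarRadius ξ R κ S) (hχ : IsPlateau χ S)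
    {z : ℂ} (hz : z ∈ Metric.ball (0 : ℂ) R) (hzξ : z ∉ range ξ)
    (hfc : Integrable (farCauchyKernel S ξ c z)) (hfd : Integrable (farDipoleKernel χ ξ Γ z)) :
    SheetVelocityConverges a ξ γ c Γ z ∧
      sheetVelocity a ξ γ c Γ z =
        1 / (2 * Real.pi * Complex.I) * ∫ s, velocityKernel χ S ξ γ c Γ z s := by
  have hg : LocallyIntegrable (fun s => γ s - c) volume :=
    hA.locallyIntegrable.sub (continuous_const.locallyIntegrable)
  have hΓ : Continuous Γ := continuous_of_integral_eq hg hA.integral_eq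
  have hξc : Continuous ξ := hξ.continuous
  have hξ' : Continuous (deriv ξ) := hξ.continuous_deriv (by norm_num)
  have hχc : Continuous χ := hχ.smooth.continuous
  have hχ' : Continuous (deriv χ) := hχ.smooth.continuous_deriv le_rfl
  have hac : Continuous a := ha.smooth.continuous
  have ha' : Continuous (deriv a) := ha.smooth.continuous_deriv (by simp)
  have hS0 : 0 < S := zero_lt_one.trans_le hS.one_le
  have hne : ∀ s, z - ξ s ≠ 0 := fun s h => hzξ ⟨s, (sub_eq_zero.1 h).symm⟩
  set D : ℝ → ℂ := fun s => z - ξ s with hD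
  have hDc : Continuous D := by fun_prop
  have hDinv : Continuous fun s => (D s)⁻¹ := hDc.inv₀ hne
  have hDd : ∀ s, HasDerivAt D (-deriv ξ s) s := fun s => by
    simpa using ((hξ.differentiable (by norm_num)).differentiableAt.hasDerivAt).const_sub z
  set A : ℝ → ℝ := fun s => a (‖D s‖ ^ 2) with hAdef
  set P : ℝ → ℝ := fun s => 2 * deriv a (‖D s‖ ^ 2) * (deriv ξ s * starRingEnd ℂ (D s)).re with hP
  have hAc : Continuous A := by fun_prop
  have hPc : Continuous P := by
    have : Continuous fun s => (starRingEnd ℂ) (D s) := Complex.continuous_conj.comp hDc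
    fun_prop
  have hAd : ∀ s, HasDerivAt A (-P s) s := fun s => by
    have h1 := (hDd s).norm_sq
    have h2 := ((ha.smooth.differentiable (by simp)).differentiableAt.hasDerivAt
      (x := ‖D s‖ ^ 2)).comp s h1
    refine h2.congr_deriv ?_
    rw [Complex.inner, hP]
    simp only [Complex.mul_re, Complex.conj_re, Complex.conj_im, Complex.neg_re, Complex.neg_im]
    ring
  have hsq : ∀ s, S ≤ |s| → 4 ≤ ‖D s‖ ^ 2 := fun s hs => by
    have h1 := hS.le_norm z hz s hs
    have h2 : κ * S ≤ κ * |s| := mul_le_mul_of_nonneg_left hs hS.pos.le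
    have h3 : 2 ≤ ‖D s‖ := by linarith [hS.two_le]
    nlinarith
  have hA0 : ∀ s, S ≤ |s| → A s = 0 := fun s hs =>
    ha.eq_zero _ (by have := hsq s hs; rw [abs_of_nonneg (by positivity)]; linarith)
  have hP0 : ∀ s, S ≤ |s| → P s = 0 := fun s hs => by
    have := ha.deriv_eq_zero (s := ‖D s‖ ^ 2)
      (by have := hsq s hs; rw [abs_of_nonneg (by positivity)]; linarith)
    simp [hP, this]
  -- `h` compares the two cutoffs, and `h'` is its derivative
  set h : ℝ → ℂ := fun s => ((A s - χ s : ℝ) : ℂ) / D s with hh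
  set h' : ℝ → ℂ := fun s => ((-P s - deriv χ s : ℝ) : ℂ) / D s
    + ((A s - χ s : ℝ) : ℂ) * deriv ξ s / D s ^ 2 with hh'
  have hhd : ∀ s, HasDerivAt h (h' s) s := fun s => by
    have h1 : HasDerivAt (fun s => A s - χ s) (-P s - deriv χ s) s :=
      (hAd s).sub (hχ.smooth.differentiable (by simp)).differentiableAt.hasDerivAt
    refine (h1.ofReal_comp.div (hDd s) (hne s)).congr_deriv ?_
    have hDs : D s ≠ 0 := hne s
    simp only [hh']
    field_simp
    ring
  have hhc : Continuous h' := by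
    simp only [hh', div_eq_mul_inv, ← inv_pow]
    fun_prop
  have hibp := integral_complex_mul_add_deriv_mul_primitive hg hA.integral_eq hhd hhc (T := S + 2)
    (fun s hs => by
      simp [hh, hA0 s (by linarith), hχ.eq_zero s (by linarith)])
    (fun s hs => by
      simp [hh', hA0 s (by linarith), hχ.eq_zero s (by linarith), hP0 s (by linarith),
        hχ.deriv_eq_zero_of_gt (s := s) (by linarith)])
  have hnear := integrable_div_sub_curve (integrable_nearDensity hχ hA) hξc hS hz hzξ
  have hAg : Integrable fun s => ((A s * (γ s - c) : ℝ) : ℂ) :=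
    (hg.integrable_smul_left_of_hasCompactSupport hAc (hasCompactSupport_of_le_abs hA0)).ofReal
  have i1 : Integrable (integrand₁ a ξ γ c z) := integrable_div_sub_curve hAg hξc hS hz hzξ
  have hPG : Integrable fun s => ((P s * Γ s : ℝ) : ℂ) :=
    ((hPc.mul hΓ).integrable_of_hasCompactSupport
      (hasCompactSupport_of_le_abs hP0).mul_right).ofReal
  have i2 : Integrable (integrand₂ a ξ Γ z) := integrable_div_sub_curve hPG hξc hS hz hzξ
  have hcS : Integrable fun s : ℝ => ((if |s| ≤ S then c else 0 : ℝ) : ℂ) := by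
    refine ((integrable_indicator_iff measurableSet_Icc).2 (integrableOn_const (by simp)) :
      Integrable ((Icc (-S) S).indicator fun _ : ℝ => (c : ℂ))).congr (ae_of_all _ fun s => ?_)
    by_cases hs : |s| ≤ S <;> simp [indicator, abs_le.symm, hs]
  have icS := integrable_div_sub_curve hcS hξc hS hz hzξ
  have i0 : Integrable fun s => integrand₀ ξ c z s + c * truncInv S s := by
    refine (icS.add hfc).congr (ae_of_all _ fun s => ?_)
    rcases le_or_gt |s| S with hs | hs
    · simp [integrand₀, truncInv_of_le hs, farCauchyKernel, hs]
    · simp only [Pi.add_apply, integrand₀, truncInv_of_lt hs, farCauchyKernel, if_neg hs.not_ge]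
      push_cast
      ring
  have i3 : Integrable (integrand₃ a ξ Γ z) := by
    have hc : Continuous fun s => ((A s - χ s : ℝ) : ℂ) * deriv ξ s * Γ s * ((D s)⁻¹) ^ 2 := by
      fun_prop
    have hsupp : HasCompactSupport
        fun s => ((A s - χ s : ℝ) : ℂ) * deriv ξ s * Γ s * ((D s)⁻¹) ^ 2 :=
      hasCompactSupport_of_le_abs (T := S + 1) fun s hs => by
        simp [hA0 s (by linarith), hχ.eq_zero s hs]
    refine (hfd.sub (hc.integrable_of_hasCompactSupport hsupp)).congr (ae_of_all _ fun s => ?_)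
    simp only [Pi.sub_apply, farDipoleKernel, integrand₃, hAdef, hD, div_eq_mul_inv, inv_pow]
    push_cast
    ring
  have hpv := hasPVInfty_integrand₀ hξc hS0 hzξ i0
  refine ⟨⟨⟨_, hpv⟩, i1, i2, i3⟩, ?_⟩
  have iK : Integrable (velocityKernel χ S ξ γ c Γ z) := hnear.add (hfc.sub hfd)
  -- the difference of the two integrands is `(h Γ)'`
  have hpoint : ∀ s, (integrand₀ ξ c z s + c * truncInv S s) +
      (integrand₁ a ξ γ c z s - integrand₂ a ξ Γ z s - integrand₃ a ξ Γ z s)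
        - velocityKernel χ S ξ γ c Γ z s = h s * ((γ s - c : ℝ) : ℂ) + h' s * Γ s := by
    intro s
    have e1 : integrand₁ a ξ γ c z s = ((A s * (γ s - c) : ℝ) : ℂ) / D s := rfl
    have e2 : integrand₂ a ξ Γ z s = ((P s * Γ s : ℝ) : ℂ) / D s := rfl
    have e3 : integrand₃ a ξ Γ z s = ((1 - A s : ℝ) : ℂ) * deriv ξ s * Γ s / D s ^ 2 := rfl
    have e4 : farDipoleKernel χ ξ Γ z s = ((1 - χ s : ℝ) : ℂ) * deriv ξ s * Γ s / D s ^ 2 := rfl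
    have e5 : integrand₀ ξ c z s + c * truncInv S s =
        ((if |s| ≤ S then c else 0 : ℝ) : ℂ) / D s + farCauchyKernel S ξ c z s := by
      rcases le_or_gt |s| S with hs | hs
      · simp [integrand₀, truncInv_of_le hs, farCauchyKernel, hs, hD]
      · simp only [integrand₀, truncInv_of_lt hs, farCauchyKernel, if_neg hs.not_ge]
        push_cast
        ring
    rw [e5, e1, e2, e3, velocityKernel, nearDensity, e4]
    simp only [hh, hh']
    generalize (if |s| ≤ S then c else 0) = c'
    push_cast
    ring
  have key : (∫ s, (integrand₀ ξ c z s + c * truncInv S s)) +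
      ((∫ s, integrand₁ a ξ γ c z s) - (∫ s, integrand₂ a ξ Γ z s) - ∫ s, integrand₃ a ξ Γ z s)
        - ∫ s, velocityKernel χ S ξ γ c Γ z s = 0 := by
    have e1 := integral_sub i1 i2
    have e2 := integral_sub (i1.sub i2) i3
    have e3 := integral_add i0 ((i1.sub i2).sub i3)
    have e4 := integral_sub (i0.add ((i1.sub i2).sub i3)) iK
    simp only [Pi.add_apply, Pi.sub_apply, hpoint, hibp] at e2 e3 e4
    linear_combination -e1 - e2 - e3 - e4
  rw [sheetVelocity, hpv.pvInfty_eq]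
  linear_combination (1 / (2 * Real.pi * Complex.I)) * key

/-- On every ball the velocity is the integral of one jointly integrable kernel, the same for all
cutoff functions, whose `∂̄` is known for almost every value of the parameter. -/
theorem exists_velocityKernel_representation {ξ : ℝ → ℂ} {γ : ℝ → ℝ} {c : ℝ} {Γ : ℝ → ℝ}
    (hξ : ContDiff ℝ 2 ξ) (hA : IsSublinearPrimitive γ c Γ) (hchord : ChordArc ξ)
    (hspeed : ∃ M : ℝ, ∀ s, ‖deriv ξ s‖ ≤ M)
    (hdecomp : ∃ f₁ f₂ : ℝ → ℂ, MemLp f₁ 2 volume ∧ MemLp f₂ ∞ volume ∧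
      ∀ α : ℝ, ξ α - (α : ℂ) = f₁ α + f₂ α) (R : ℝ) :
    ∃ k : ℂ → ℝ → ℂ,
      Integrable (fun q : ℂ × ℝ => k q.1 q.2)
        ((volume.restrict (Metric.ball (0 : ℂ) R)).prod volume) ∧
      (∀ φ : ℂ → ℝ, ContDiff ℝ ∞ φ → HasCompactSupport φ → tsupport φ ⊆ Metric.ball 0 R →
        ∀ᵐ s, ∫ z, dbarTwice φ z * k z s = -(2 * Real.pi) * ((γ s * φ (ξ s) : ℝ) : ℂ)) ∧
      ∀ a, IsCutoff a → ∀ z ∈ Metric.ball (0 : ℂ) R, z ∉ range ξ →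
        SheetVelocityConverges a ξ γ c Γ z ∧
        sheetVelocity a ξ γ c Γ z = 1 / (2 * Real.pi * Complex.I) * ∫ s, k z s := by
  obtain ⟨M, hM⟩ := hspeed
  obtain ⟨S₀, hb⟩ := exists_integrable_farDipoleKernel_bound hA hM
  obtain ⟨κ, S, hS₀, hS⟩ := hchord.exists_isFarRadius R S₀
  obtain ⟨χ, hχ⟩ := exists_isPlateau (zero_lt_one.trans_le hS.one_le)
  obtain ⟨b₃, hb₃, hle₃⟩ := hb χ R κ S hS₀ hS hχ
  obtain ⟨b₀, hb₀, hle₀⟩ := exists_integrable_farCauchyKernel_bound hξ.continuous c hS hdecomp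
  have hg : LocallyIntegrable (fun s => γ s - c) volume :=
    hA.locallyIntegrable.sub (continuous_const.locallyIntegrable)
  have hΓ : Continuous Γ := continuous_of_integral_eq hg hA.integral_eq
  have hm₀ := measurable_farCauchyKernel S hξ.continuous.measurable c
  have hm₃ := measurable_farDipoleKernel hχ.smooth.continuous.measurable hξ.continuous.measurable
    hΓ.measurable
  have hnear := integrable_cauchyKernel (integrable_nearDensity hχ hA) hξ.continuous R
  have hfar := (integrable_prod_of_norm_le hm₀ hb₀ hle₀).sub
    (integrable_prod_of_norm_le hm₃ hb₃ hle₃)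
  refine ⟨velocityKernel χ S ξ γ c Γ, hnear.add hfar, fun φ hφ hc hsupp => ?_,
    fun a ha z hz hzξ => ?_⟩
  · filter_upwards [hnear.prod_left_ae, hfar.prod_left_ae] with s h₁ h₂
    exact integral_dbarTwice_mul_velocityKernel hS hχ hφ hc hsupp h₁ h₂
  · exact sheetVelocity_eq_integral_velocityKernel ha hξ hA hS hχ hz hzξ
      (hb₀.mono' (hm₀.comp measurable_prodMk_left).aestronglyMeasurable (ae_of_all _ (hle₀ z hz)))
      (hb₃.mono' (hm₃.comp measurable_prodMk_left).aestronglyMeasurable (ae_of_all _ (hle₃ z hz)))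

/-! ### Divergence and vorticity -/

theorem theorem1 (ξ : ℝ → ℂ) (γ : ℝ → ℝ) (c : ℝ) (Γ : ℝ → ℝ)
    (hγ : IsLocallyL2 γ) (hξ : ContDiff ℝ 2 ξ)
    (hA : IsSublinearPrimitive γ c Γ)
    (hC : ApproximableByDecaying ξ (fun α => γ α - c))
    (hB : CauchyPVConverges ξ ∨ c = 0)
    (hchord : ChordArc ξ)
    (hspeed : ∃ M > (0 : ℝ), ∀ α : ℝ, 1 / M ≤ ‖deriv ξ α‖ ∧ ‖deriv ξ α‖ ≤ M)
    (hdecomp : ∃ f₁ f₂ : ℝ → ℂ, MemLp f₁ 2 volume ∧ MemLp f₂ ∞ volume ∧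
      ∀ α : ℝ, ξ α - (α : ℂ) = f₁ α + f₂ α) :
    (∀ a : ℝ → ℝ, IsCutoff a →
      (∀ z : ℂ, z ∉ range ξ → SheetVelocityConverges a ξ γ c Γ z) ∧
      LocallyIntegrable (sheetVelocity a ξ γ c Γ) volume ∧
      DivergenceFree (sheetVelocity a ξ γ c Γ) ∧
      HasSheetVorticity (sheetVelocity a ξ γ c Γ) γ ξ) ∧
    (∀ a b : ℝ → ℝ, IsCutoff a → IsCutoff b → ∀ z : ℂ, z ∉ range ξ →
      sheetVelocity a ξ γ c Γ z = sheetVelocity b ξ γ c Γ z) := by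
  have hspeed' : ∃ M : ℝ, ∀ s, ‖deriv ξ s‖ ≤ M :=
    let ⟨M, _, hM⟩ := hspeed
    ⟨M, fun s => (hM s).2⟩
  have hrep := exists_velocityKernel_representation hξ hA hchord hspeed' hdecomp
  have hmem : ∀ z : ℂ, z ∈ Metric.ball (0 : ℂ) (‖z‖ + 1) := fun z => by simp
  have hnull : ∀ᵐ z : ℂ, z ∉ range ξ :=
    measure_eq_zero_iff_ae_notMem.1 (volume_range_curve (hξ.differentiable (by norm_num)))
  refine ⟨fun a ha => ?_, fun a b ha hb z hz => ?_⟩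
  swap
  · obtain ⟨k, -, -, hk⟩ := hrep (‖z‖ + 1)
    rw [(hk a ha z (hmem z) hz).2, (hk b hb z (hmem z) hz).2]
  have hloc : ∀ R, IntegrableOn (sheetVelocity a ξ γ c Γ) (Metric.ball 0 R) := fun R => by
    obtain ⟨k, hi, -, hk⟩ := hrep R
    refine (hi.integral_prod_left.const_mul (1 / (2 * Real.pi * Complex.I))).congr ?_
    filter_upwards [ae_restrict_of_ae hnull, ae_restrict_mem measurableSet_ball] with z h1 h2
    exact (hk a ha z h2 h1).2.symm
  -- `2 ∂̄ φ * w` has real part `u φ_x + v φ_y` and imaginary part `u φ_y - v φ_x`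
  have hdist : ∀ φ : ℂ → ℝ, ContDiff ℝ ∞ φ → HasCompactSupport φ →
      Integrable (fun z => dbarTwice φ z * sheetVelocity a ξ γ c Γ z) ∧
      ∫ z, dbarTwice φ z * sheetVelocity a ξ γ c Γ z =
        ((∫ s, γ s * φ (ξ s) : ℝ) : ℂ) * Complex.I := by
    intro φ hφ hc
    obtain ⟨R, hR⟩ := hc.isCompact.isBounded.subset_ball (0 : ℂ)
    obtain ⟨k, hi, hdbar, hk⟩ := hrep R
    refine ⟨integrable_dbarTwice_mul hφ hc hR (hloc R), ?_⟩
    calc ∫ z, dbarTwice φ z * sheetVelocity a ξ γ c Γ z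
        = ∫ z, 1 / (2 * Real.pi * Complex.I) * (dbarTwice φ z * ∫ s, k z s) := by
          refine integral_congr_ae ?_
          filter_upwards [hnull] with z hz
          by_cases hzs : z ∈ Metric.ball (0 : ℂ) R
          · simp only [(hk a ha z hzs hz).2]
            ring
          · have : dbarTwice φ z = 0 :=
              Function.notMem_support.1 fun h => hzs (hR (support_dbarTwice_subset φ h))
            simp [this]
      _ = 1 / (2 * Real.pi * Complex.I) * ∫ s, -(2 * Real.pi) * ((γ s * φ (ξ s) : ℝ) : ℂ) := by
          rw [integral_const_mul, integral_dbarTwice_mul_integral hφ hc hR hi,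
            integral_congr_ae (hdbar φ hφ hc hR)]
      _ = _ := by
          rw [integral_const_mul, integral_complex_ofReal]
          have hpi : (Real.pi : ℂ) ≠ 0 := by exact_mod_cast Real.pi_ne_zero
          field_simp
          rw [Complex.I_sq]
          ring
  refine ⟨fun z hz => ?_, ?_, fun φ hφ hc => ?_, fun φ hφ hc => ?_⟩
  · obtain ⟨k, -, -, hk⟩ := hrep (‖z‖ + 1)
    exact (hk a ha z (hmem z) hz).1
  · refine locallyIntegrable_iff.2 fun K hK => ?_
    obtain ⟨R, hR⟩ := hK.isBounded.subset_ball (0 : ℂ)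
    exact (hloc R).mono_set hR
  · obtain ⟨hi, he⟩ := hdist φ hφ hc
    have h1 := (Complex.reCLM.integral_comp_comm hi).trans (congrArg Complex.reCLM he)
    rw [Complex.reCLM_apply, Complex.re_ofReal_mul, Complex.I_re, mul_zero] at h1
    rw [← h1]
    congr 1
    ext z
    simp [dbarTwice]
    ring
  · obtain ⟨hi, he⟩ := hdist φ hφ hc
    have h1 := (Complex.imCLM.integral_comp_comm hi).trans (congrArg Complex.imCLM he)
    rw [Complex.imCLM_apply, Complex.im_ofReal_mul, Complex.I_im, mul_one] at h1
    rw [← h1, ← integral_neg]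
    congr 1
    ext z
    simp [dbarTwice]
    ring
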